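/- A Markov decision process (MDP) consists of a finite non-empty vertex set $V$, $|V|=n$, partitioned into player-1 vertices $V_1$ and random vertices $V_R$, an edge set $E\subseteq V\times V$ without self-loops in which every vertex has an outgoing edge, and for every $v\in V_R$ a probability distribution on $V$ whose support is $\{w : (v,w)\in E\}$. An end-component is a non-empty set $X\subseteq V$ such that the subgraph induced by $X$ is strongly connected (a single vertex counts as strongly connected) and every edge that leaves a random vertex of $X$ ends in $X$. A maximal end-component (MEC) is an end-component that is maximal under inclusion. The MEC decomposition consists of all MECs together with the set of the vertices that belong to no MEC. In the set-based symbolic model, an algorithm is a finite deterministic random-access program (with arithmetic on natural numbers, indirect addressing and recursive procedures) that accesses the MDP only through stored sets of vertices and of edges, initially $V,V_1,V_R,E$, by the following symbolic operations: $\cup,\cap,\setminus$ and the tests $\subseteq,=$ on two vertex sets or two edge sets; the product $X\times Y$ of two vertex sets; $\mathrm{Pre}_F(X)=\{v : \exists w\in X,\ (v,w)\in F\}$ and $\mathrm{Post}_F(X)=\{v : \exists w\in X,\ (w,v)\in F\}$ for a stored edge set $F$ and a stored vertex set $X$; picking an arbitrary vertex of a non-empty vertex set (stored as a singleton set); the cardinality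 of a vertex set; and output of a vertex set. Each of them costs one symbolic operation; computations with numbers are free. The symbolic space is the number of registers that the run uses for storing sets; it bounds the number of sets stored at any one time. A program computes the MEC decomposition within given bounds if, on every MDP and however the picked vertices are selected, it halts within these bounds, having put out every MEC exactly once and finally the set of the vertices in no MEC. **Theorem.** (1) There is a program that receives, besides the MDP, one natural number as a parameter, such that for every real $0<\epsilon\le 1/2$ there is a constant $C$ for which the program, given any MDP with $n$ vertices and the parameter $\lceil n^{\epsilon}\rceil$, computes the MEC decomposition with at most $C\,n^{2-\epsilon}\log n$ symbolic operations and symbolic space at most $C\,n^{\epsilon}\log n$. (2) For every rational $0<\epsilon\le 1/2$ there are a program without parameter and a constant $C$ such that the program computes the MEC decomposition of every MDP with $n$ vertices with at most $C\,n^{2-\epsilon}\log n$ symbolic operations and symbolic space at most $C\,n^{\epsilon}\log n$. (3) In particular, some program without parameter computes the MEC decomposition of every MDP with $n$ vertices in $O(n^{3/2}\log n)$ symbolic operations and $O(\sqrt n\,\log n)$ symbolic space. -/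

import Mathlib

/-! ## Markov decision processes and maximal end-components -/

/-- A Markov decision process on the finite vertex set `V`: the vertices in `random` are the random
vertices, all the others are player-1 vertices. There are no self-loops, and every vertex has an
outgoing edge. -/
structure MDP (V : Type*) [Fintype V] [DecidableEq V] where
  edges : Finset (V × V)
  random : Finset V
  /-- the probabilistic transition function, on the random vertices -/
  trans : {v : V // v ∈ random} → PMF V
  mem_edges_iff : ∀ (v : {v : V // v ∈ random}) (w : V), (v.1, w) ∈ edges ↔ 0 < trans v w
  no_loop : ∀ v : V, (v, v) ∉ edges
  exists_succ : ∀ v : V, ∃ w : V, (v, w) ∈ edges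

namespace MDP

variable {V : Type*} [Fintype V] [DecidableEq V]

/-- The player-1 vertices. -/
def player1 (P : MDP V) : Finset V := P.randomᶜ

/-- The subgraph induced by `X` is strongly connected. -/
def StronglyConnected (P : MDP V) (X : Finset V) : Prop :=
  ∀ u ∈ X, ∀ v ∈ X,
    Relation.ReflTransGen (fun a b => a ∈ X ∧ b ∈ X ∧ (a, b) ∈ P.edges) u v

/-- End-components; a single player-1 vertex is a (trivial) end-component. -/
def IsEC (P : MDP V) (X : Finset V) : Prop :=
  X.Nonempty ∧ P.StronglyConnected X ∧
    ∀ v ∈ X, v ∈ P.random → ∀ w, (v, w) ∈ P.edges → w ∈ X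

/-- Maximal end-components: end-components that are maximal under inclusion. -/
def IsMEC (P : MDP V) (X : Finset V) : Prop := Maximal P.IsEC X

/-- The list `l` presents the MEC decomposition: it lists every MEC exactly once, and ends with the
(possibly empty) set of the vertices that belong to no MEC. -/
def IsMECDecomposition (P : MDP V) (l : List (Finset V)) : Prop :=
  ∃ (mecs : List (Finset V)) (rest : Finset V), l = mecs ++ [rest] ∧
    mecs.Nodup ∧ (∀ X, X ∈ mecs ↔ P.IsMEC X) ∧
    ∀ v, v ∈ rest ↔ ∀ X, P.IsMEC X → v ∉ X

end MDP

/-! ## The set-based symbolic model of computation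

A symbolic algorithm is a finite program for a random access machine with three memories, each
indexed by the natural numbers and addressed indirectly: natural numbers, sets of vertices, sets of
edges. Programs know nothing about `V`: they reach the MDP only by the symbolic instructions, and
a picked vertex is only available as a singleton set. -/

namespace Symbolic

/-- Expressions over the numeric memory; they serve as values, conditions and addresses. -/
inductive NExp : Type
  | const (k : ℕ)
  | reg (a : NExp)
  | add (e f : NExp)
  | sub (e f : NExp)
  | mul (e f : NExp)
  | div (e f : NExp)

/-- `reg a` is the content of the numeric register whose address is the value of `a`; subtraction
is truncated and division is rounded down. -/
def NExp.eval (m : ℕ → ℕ) : NExp → ℕ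
  | .const k => k
  | .reg a => m (a.eval m)
  | .add e f => e.eval m + f.eval m
  | .sub e f => e.eval m - f.eval m
  | .mul e f => e.eval m * f.eval m
  | .div e f => e.eval m / f.eval m

inductive SetOp : Type
  | union
  | inter
  | diff

def SetOp.eval {α : Type*} [DecidableEq α] : SetOp → Finset α → Finset α → Finset α
  | .union, X, Y => X ∪ Y
  | .inter, X, Y => X ∩ Y
  | .diff, X, Y => X \ Y

inductive SetTest : Type
  | subset
  | eq

/-- The outcome of a test is `1` for true and `0` for false. -/
def SetTest.eval {α : Type*} [DecidableEq α] : SetTest → Finset α → Finset α → ℕ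
  | .subset, X, Y => if X ⊆ Y then 1 else 0
  | .eq, X, Y => if X = Y then 1 else 0

/-- Symbolic instructions. All arguments are addresses; `d` is the address of the result. -/
inductive Instr : Type
  | vertOp (o : SetOp) (d a b : NExp)
  | edgeOp (o : SetOp) (d a b : NExp)
  | vertTest (t : SetTest) (d a b : NExp)
  | edgeTest (t : SetTest) (d a b : NExp)
  | prod (d a b : NExp)
  | pre (d e a : NExp)
  | post (d e a : NExp)
  | pick (d a : NExp)
  | card (d a : NExp)
  | emit (a : NExp)

/-- Statements. Conditions hold when their value is nonzero; `call p` runs the procedure number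
`p`. -/
inductive Stmt : Type
  | skip
  | assign (d e : NExp)
  | sym (i : Instr)
  | seq (s t : Stmt)
  | ite (c : NExp) (s t : Stmt)
  | loop (c : NExp) (s : Stmt)
  | call (p : ℕ)

/-- A program: a main statement and finitely many procedures, which may be recursive. -/
structure Program : Type where
  main : Stmt
  procs : List Stmt

section Semantics

variable {V : Type*} [Fintype V] [DecidableEq V]

/-- The vertices with an edge of `E` into `S`. -/
def pre (E : Finset (V × V)) (S : Finset V) : Finset V :=
  Finset.univ.filter fun v => ∃ w ∈ S, (v, w) ∈ E

/-- The vertices with an edge of `E` from `S`. -/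
def post (E : Finset (V × V)) (S : Finset V) : Finset V :=
  Finset.univ.filter fun v => ∃ w ∈ S, (w, v) ∈ E

/-- Machine states: the three memories, the sets put out so far, the number of symbolic operations
so far, and the numbers of registers reserved so far for sets of vertices and for sets of edges. -/
structure State (V : Type*) where
  num : ℕ → ℕ
  vert : ℕ → Finset V
  edge : ℕ → Finset (V × V)
  out : List (Finset V)
  ops : ℕ
  vertRegs : ℕ
  edgeRegs : ℕ

/-- Symbolic space: the registers `0, 1, …` up to the largest address at which a set was ever
stored all count, so this is at least the number of sets stored at any one time. -/
def State.space (σ : State V) : ℕ := σ.vertRegs + σ.edgeRegs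

def State.setNum (σ : State V) (d k : ℕ) : State V :=
  { σ with num := Function.update σ.num d k }

def State.setVert (σ : State V) (d : ℕ) (X : Finset V) : State V :=
  { σ with vert := Function.update σ.vert d X, vertRegs := max σ.vertRegs (d + 1) }

def State.setEdge (σ : State V) (d : ℕ) (F : Finset (V × V)) : State V :=
  { σ with edge := Function.update σ.edge d F, edgeRegs := max σ.edgeRegs (d + 1) }

/-- The effect of a symbolic instruction on the memories and the output. Which vertex of `S` is
returned by a pick after `t` symbolic operations is decided by `choice t S`. -/
def Instr.effect (choice : ℕ → Finset V → V) (σ : State V) : Instr → State V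
  | .vertOp o d a b =>
      σ.setVert (d.eval σ.num) (o.eval (σ.vert (a.eval σ.num)) (σ.vert (b.eval σ.num)))
  | .edgeOp o d a b =>
      σ.setEdge (d.eval σ.num) (o.eval (σ.edge (a.eval σ.num)) (σ.edge (b.eval σ.num)))
  | .vertTest t d a b =>
      σ.setNum (d.eval σ.num) (t.eval (σ.vert (a.eval σ.num)) (σ.vert (b.eval σ.num)))
  | .edgeTest t d a b =>
      σ.setNum (d.eval σ.num) (t.eval (σ.edge (a.eval σ.num)) (σ.edge (b.eval σ.num)))
  | .prod d a b =>
      σ.setEdge (d.eval σ.num) (σ.vert (a.eval σ.num) ×ˢ σ.vert (b.eval σ.num))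
  | .pre d e a =>
      σ.setVert (d.eval σ.num) (Symbolic.pre (σ.edge (e.eval σ.num)) (σ.vert (a.eval σ.num)))
  | .post d e a =>
      σ.setVert (d.eval σ.num) (Symbolic.post (σ.edge (e.eval σ.num)) (σ.vert (a.eval σ.num)))
  | .pick d a =>
      σ.setVert (d.eval σ.num)
        (if (σ.vert (a.eval σ.num)).Nonempty then {choice σ.ops (σ.vert (a.eval σ.num))} else ∅)
  | .card d a => σ.setNum (d.eval σ.num) (σ.vert (a.eval σ.num)).card
  | .emit a => { σ with out := σ.out ++ [σ.vert (a.eval σ.num)] }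

/-- Every symbolic instruction counts as one symbolic operation. -/
def Instr.step (choice : ℕ → Finset V → V) (i : Instr) (σ : State V) : State V :=
  { i.effect choice σ with ops := σ.ops + 1 }

/-- `Exec choice procs s σ τ`: started in state `σ`, the statement `s` terminates in state `τ`. -/
inductive Exec (choice : ℕ → Finset V → V) (procs : List Stmt) :
    Stmt → State V → State V → Prop
  | skip (σ : State V) : Exec choice procs .skip σ σ
  | assign (d e : NExp) (σ : State V) :
      Exec choice procs (.assign d e) σ (σ.setNum (d.eval σ.num) (e.eval σ.num))
  | sym (i : Instr) (σ : State V) : Exec choice procs (.sym i) σ (i.step choice σ)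
  | seq {s t : Stmt} {σ τ υ : State V} :
      Exec choice procs s σ τ → Exec choice procs t τ υ → Exec choice procs (.seq s t) σ υ
  | ite_true {c : NExp} {s t : Stmt} {σ τ : State V} :
      c.eval σ.num ≠ 0 → Exec choice procs s σ τ → Exec choice procs (.ite c s t) σ τ
  | ite_false {c : NExp} {s t : Stmt} {σ τ : State V} :
      c.eval σ.num = 0 → Exec choice procs t σ τ → Exec choice procs (.ite c s t) σ τ
  | loop_true {c : NExp} {s : Stmt} {σ τ υ : State V} :
      c.eval σ.num ≠ 0 → Exec choice procs s σ τ → Exec choice procs (.loop c s) τ υ →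
      Exec choice procs (.loop c s) σ υ
  | loop_false {c : NExp} {s : Stmt} {σ : State V} :
      c.eval σ.num = 0 → Exec choice procs (.loop c s) σ σ
  | call {p : ℕ} {s : Stmt} {σ τ : State V} :
      procs[p]? = some s → Exec choice procs s σ τ → Exec choice procs (.call p) σ τ

/-- The final state is determined by the initial one. -/
theorem Exec.deterministic {choice : ℕ → Finset V → V} {procs : List Stmt} {s : Stmt}
    {σ τ τ' : State V} (h : Exec choice procs s σ τ) (h' : Exec choice procs s σ τ') :
    τ = τ' := by
  induction h generalizing τ' with
  | skip | assign | sym => cases h'; rfl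
  | seq _ _ ih₁ ih₂ =>
    cases h' with
    | seq h₁ h₂ => cases ih₁ h₁; exact ih₂ h₂
  | ite_true hc _ ih =>
    cases h' with
    | ite_true _ h => exact ih h
    | ite_false hc' _ => exact absurd hc' hc
  | ite_false hc _ ih =>
    cases h' with
    | ite_true hc' _ => exact absurd hc hc'
    | ite_false _ h => exact ih h
  | loop_true hc _ _ ih₁ ih₂ =>
    cases h' with
    | loop_true _ h₁ h₂ => cases ih₁ h₁; exact ih₂ h₂
    | loop_false hc' => exact absurd hc' hc
  | loop_false hc =>
    cases h' with
    | loop_true hc' _ _ => exact absurd hc hc'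
    | loop_false _ => rfl
  | call hp _ ih =>
    cases h' with
    | call hp' h => cases hp.symm.trans hp'; exact ih h

/-- The initial state: the vertex registers `0, 1, 2` hold the set of all vertices, of the player-1
vertices and of the random vertices, the edge register `0` holds the edge set, and the numeric
register `0` holds the parameter `k`. -/
def init (P : MDP V) (k : ℕ) : State V where
  num := fun i => if i = 0 then k else 0
  vert := fun i =>
    if i = 0 then Finset.univ else if i = 1 then P.player1 else if i = 2 then P.random else ∅
  edge := fun i => if i = 0 then P.edges else ∅
  out := []
  ops := 0
  vertRegs := 3
  edgeRegs := 1

/-- On the MDP `P` with numeric parameter `k`, and however the picked vertices are selected, the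
program halts having put out the MEC decomposition of `P`, after at most `T` symbolic operations and
with symbolic space at most `S`. -/
def Program.ComputesMECs (prog : Program) (P : MDP V) (k : ℕ) (T S : ℝ) : Prop :=
  ∀ choice : ℕ → Finset V → V, (∀ t X, X.Nonempty → choice t X ∈ X) →
    ∃ σ : State V, Exec choice prog.procs prog.main (init P k) σ ∧
      P.IsMECDecomposition σ.out ∧ (σ.ops : ℝ) ≤ T ∧ (σ.space : ℝ) ≤ S

end Semantics

end Symbolic

/-! ## Finding MECs as bottom components -/

namespace MDP

variable {V : Type*} [Fintype V] [DecidableEq V]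

/-! A single program with O(n^{3/2} log n) symbolic operations and only O(log n) stored sets serves
all three claims, because for ε ≤ 1/2 one has n^{3/2} ≤ n^{2-ε} and log n ≤ n^ε log n. It exploits
that computations with numbers are free. The vertices are numbered once. About log₂ n sets, one for
each bit, translate between a singleton and its number in O(log n) operations, and all that is
learned about edges is kept in numeric arrays.

Let A be the set of undecided vertices; no edge of a random vertex of A leaves A. A bottom strongly
connected component C of the graph induced by A is a MEC (`Partial.isMEC_of_isRoot`). It is put out
and removed, together with the random vertices that, round by round, have an edge into the removed
part; these lie in no MEC that remains (`Partial.remove`). This costs O(log n) per removed vertex,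
hence O(n log n) altogether.

The difficulty is to find a vertex of a bottom component cheaply. Let h be about √n. A refresh
records the successors of every undecided vertex that has at most 2h undecided successors; it is
repeated whenever at least h vertices have been decided since the last one. In between, a purely
numeric search looks for a bottom component all of whose vertices have recorded successors
(`searchKnown_spec`). If there is none, a symbolic search with O(n) operations is used
(`searchRoot_spec`). The component it finds then contains an unrecorded vertex, which had more than
2h undecided successors at the last refresh and still has more than h. All of them lie in the
component, so at least h vertices are removed.

Hence there are O(n/h) refreshes of O(n log n) operations each, not counting the recording of edges,
O(n/h) symbolic searches of O(n) operations each, and O(nh) recorded edges at O(log n) each. The sum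
is O((n²/h + nh) log n). The amortization is carried by `potential`, which no round increases
(`iteration_spec`). -/

/-- Reachability in the subgraph induced by `A`. -/
def Reach (P : MDP V) (A : Finset V) : V → V → Prop :=
  Relation.ReflTransGen fun a b => a ∈ A ∧ b ∈ A ∧ (a, b) ∈ P.edges

/-- `r` lies in a bottom strongly connected component of the subgraph induced by `A`. -/
def IsRoot (P : MDP V) (A : Finset V) (r : V) : Prop :=
  r ∈ A ∧ ∀ w, P.Reach A r w → P.Reach A w r

theorem Reach.mem {P : MDP V} {A : Finset V} {u v : V} (h : P.Reach A u v) (hu : u ∈ A) :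
    v ∈ A := by
  induction h with
  | refl => exact hu
  | tail _ h _ => exact h.2.1

theorem Reach.mono {P : MDP V} {A B : Finset V} (hAB : A ⊆ B) {u v : V} (h : P.Reach A u v) :
    P.Reach B u v :=
  Relation.ReflTransGen.mono (fun _ _ h => ⟨hAB h.1, hAB h.2.1, h.2.2⟩) _ _ h

/-- A predicate that holds at `v` and is inherited by predecessors holds at every vertex that
reaches `v`. -/
theorem Reach.of_pre_closed {P : MDP V} {A : Finset V} {p : V → Prop} {u v : V}
    (h : P.Reach A u v)
    (hp : ∀ a ∈ A, ∀ b ∈ A, (a, b) ∈ P.edges → p b → p a) (hv : p v) : p u := by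
  induction h with
  | refl => exact hv
  | tail _ h ih => exact ih (hp _ h.1 _ h.2.1 h.2.2 hv)

/-- If every vertex outside of a predecessor-closed set `p` reaches `r`, and `r` is outside of it,
then `r` lies in a bottom component. -/
theorem isRoot_of_pre_closed {P : MDP V} {A : Finset V} {p : V → Prop} {r : V} (hr : r ∈ A)
    (hp : ∀ a ∈ A, ∀ b ∈ A, (a, b) ∈ P.edges → p b → p a) (hrp : ¬ p r)
    (h : ∀ v ∈ A, p v ∨ P.Reach A v r) : P.IsRoot A r := by
  refine ⟨hr, fun w hw => ?_⟩
  rcases h w (hw.mem hr) with h | h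
  · exact absurd (hw.of_pre_closed hp h) hrp
  · exact h

theorem IsEC.exists_isMEC {P : MDP V} {X : Finset V} (h : P.IsEC X) :
    ∃ Y, P.IsMEC Y ∧ X ⊆ Y := by
  obtain ⟨Y, hXY, hY⟩ := (Set.toFinite {Y | P.IsEC Y}).exists_le_maximal h
  exact ⟨Y, hY, hXY⟩

/-- Without loops a successor is a second vertex. This keeps log n away from 0, so that additive
constants can be absorbed into multiples of it. -/
theorem one_lt_card (P : MDP V) [Nonempty V] : 1 < Fintype.card V := by
  obtain ⟨v⟩ := ‹Nonempty V›
  obtain ⟨w, hw⟩ := P.exists_succ v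
  refine Fintype.one_lt_card_iff.2 ⟨v, w, fun h => ?_⟩
  subst h
  exact P.no_loop _ hw

/-- The MECs in `out` have been found, the vertices in `A` are still undecided, and `R` is the set
of the decided vertices in no MEC. -/
structure Partial (P : MDP V) (A R : Finset V) (out : List (Finset V)) : Prop where
  closed : ∀ v ∈ A, v ∈ P.random → ∀ w, (v, w) ∈ P.edges → w ∈ A
  nodup : out.Nodup
  isMEC : ∀ X ∈ out, P.IsMEC X
  disj : ∀ X ∈ out, Disjoint X A
  cover : ∀ X, P.IsMEC X → X ∈ out ∨ X ⊆ A
  rest : ∀ v, v ∈ R ↔ v ∉ A ∧ ∀ X ∈ out, v ∉ X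

theorem partial_univ (P : MDP V) : P.Partial Finset.univ ∅ [] where
  closed := by simp
  nodup := by simp
  isMEC := by simp
  disj := by simp
  cover := by simp
  rest := by simp

theorem Partial.isMECDecomposition {P : MDP V} {R : Finset V} {out : List (Finset V)}
    (h : P.Partial ∅ R out) : P.IsMECDecomposition (out ++ [R]) := by
  have key : ∀ X, X ∈ out ↔ P.IsMEC X := fun X => ⟨h.isMEC X, fun hX =>
    (h.cover X hX).resolve_right fun h0 => by
      have := hX.1.1
      rw [Finset.subset_empty.1 h0] at this
      simp at this⟩
  refine ⟨out, R, rfl, h.nodup, key, fun v => ?_⟩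
  rw [h.rest]
  simp [key]

section Step

variable {P : MDP V} {A R : Finset V} {out : List (Finset V)} {r : V} {C : Finset V}

/-- A walk in `A` from a vertex of `C` stays in `C`, and since `r` is in a bottom component it can
be continued to `r`. The field `closed` keeps random edges in `A`, hence in `C`. For maximality, an
end-component that contains `C` lies in a MEC through `r`; that MEC is not in `out`, so it lies
inside `A` and all of it is reached from `r`. -/
theorem Partial.isMEC_of_isRoot (h : P.Partial A R out) (hr : P.IsRoot A r)
    (hC : ∀ w, w ∈ C ↔ P.Reach A r w) : P.IsMEC C := by
  have hrC : r ∈ C := (hC r).2 .refl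
  have hCA : C ⊆ A := fun w hw => ((hC w).1 hw).mem hr.1
  have hcl : ∀ u ∈ C, ∀ v, P.Reach A u v → P.Reach C u v := by
    intro u hu v huv
    induction huv with
    | refl => exact .refl
    | @tail b c hb hbc ih =>
      have h1 : b ∈ C := (hC b).2 (((hC u).1 hu).trans hb)
      exact ih.tail ⟨h1, (hC c).2 (((hC b).1 h1).tail hbc), hbc.2.2⟩
  have hEC : P.IsEC C := by
    refine ⟨⟨r, hrC⟩, fun u hu v hv => ?_, fun v hv hvr w hw => ?_⟩
    · exact hcl u hu v ((hr.2 u ((hC u).1 hu)).trans ((hC v).1 hv))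
    · have hv' := (hC v).1 hv
      exact (hC w).2 (hv'.tail ⟨hCA hv, h.closed v (hCA hv) hvr w hw, hw⟩)
  refine ⟨hEC, fun X hX hCX => ?_⟩
  obtain ⟨Y, hY, hXY⟩ := hX.exists_isMEC
  have hYA : Y ⊆ A := (h.cover Y hY).resolve_left fun hY' =>
    Finset.disjoint_left.1 (h.disj Y hY') (hXY (hCX hrC)) hr.1
  intro x hx
  exact (hC x).2 (Reach.mono (hXY.trans hYA) (hX.2.1 r (hCX hrC) x hx))

/-- A common vertex makes all of `X` reachable from `r` within `A`, so `X ⊆ C`, and maximality of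
`X` forces equality. -/
theorem Partial.disjoint_of_ne (h : P.Partial A R out) (hr : P.IsRoot A r)
    (hC : ∀ w, w ∈ C ↔ P.Reach A r w) {X : Finset V} (hX : P.IsMEC X) (hXA : X ⊆ A)
    (hne : X ≠ C) : Disjoint X C := by
  refine Finset.disjoint_left.2 fun x hx hxC => hne ?_
  have hXC : X ⊆ C := fun y hy =>
    (hC y).2 (((hC x).1 hxC).trans (Reach.mono hXA (hX.1.2.1 x hx y hy)))
  exact hXC.antisymm (hX.2 (h.isMEC_of_isRoot hr hC).1 hXC)

/-- Removing a bottom component `C` together with a set `S` that meets no other MEC. -/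
theorem Partial.remove (h : P.Partial A R out) (hr : P.IsRoot A r)
    (hC : ∀ w, w ∈ C ↔ P.Reach A r w) {S : Finset V} (hSA : S ⊆ A) (hSC : Disjoint S C)
    (hS : ∀ X, P.IsMEC X → X ⊆ A → X ≠ C → Disjoint X S)
    (hcl : ∀ v ∈ (A \ C) \ S, v ∈ P.random → ∀ w, (v, w) ∈ P.edges → w ∈ (A \ C) \ S) :
    P.Partial ((A \ C) \ S) (R ∪ S) (out ++ [C]) := by
  have hrC : r ∈ C := (hC r).2 .refl
  have hCA : C ⊆ A := fun w hw => ((hC w).1 hw).mem hr.1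
  have hsub : (A \ C) \ S ⊆ A := Finset.sdiff_subset.trans Finset.sdiff_subset
  refine ⟨hcl, ?_, ?_, ?_, ?_, ?_⟩
  · rw [List.nodup_append]
    refine ⟨h.nodup, by simp, ?_⟩
    rintro X hX Y hY rfl
    rw [List.mem_singleton.1 hY] at hX
    exact Finset.disjoint_left.1 (h.disj C hX) hrC hr.1
  · intro X hX
    rcases List.mem_append.1 hX with hX | hX
    · exact h.isMEC X hX
    · rw [List.mem_singleton.1 hX]
      exact h.isMEC_of_isRoot hr hC
  · intro X hX
    rcases List.mem_append.1 hX with hX | hX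
    · exact (h.disj X hX).mono_right hsub
    · rw [List.mem_singleton.1 hX]
      exact Finset.disjoint_left.2 fun x hx hx' => by simp [hx] at hx'
  · intro X hX
    rcases h.cover X hX with h1 | h1
    · exact Or.inl (List.mem_append_left _ h1)
    · by_cases hXC : X = C
      · exact Or.inl (by simp [hXC])
      · right
        intro x hx
        have h2 := Finset.disjoint_left.1 (h.disjoint_of_ne hr hC hX h1 hXC) hx
        have h3 := Finset.disjoint_left.1 (hS X hX h1 hXC) hx
        simp [h1 hx, h2, h3]
  · intro v
    have h1 := h.rest v
    have h2 : v ∈ S → v ∈ A := fun hv => hSA hv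
    have h3 : v ∈ S → v ∉ C := fun hv => Finset.disjoint_left.1 hSC hv
    have h4 : v ∈ C → v ∈ A := fun hv => hCA hv
    have h5 : ∀ X ∈ out, v ∈ X → v ∉ A := fun X hX hv => Finset.disjoint_left.1 (h.disj X hX) hv
    simp only [Finset.mem_union, Finset.mem_sdiff, List.mem_append, List.mem_singleton, h1]
    constructor
    · rintro (⟨h6, h7⟩ | h6)
      · refine ⟨by tauto, ?_⟩
        rintro X (hX | rfl)
        · exact h7 X hX
        · tauto
      · refine ⟨by tauto, ?_⟩
        rintro X (hX | rfl) hv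
        · exact h5 X hX hv (h2 h6)
        · exact h3 h6 hv
    · rintro ⟨h6, h7⟩
      have h8 := h7 C (Or.inr rfl)
      by_cases hvS : v ∈ S
      · exact Or.inr hvS
      · refine Or.inl ⟨fun hvA => h6 ⟨⟨hvA, h8⟩, hvS⟩, fun X hX => h7 X (Or.inl hX)⟩

end Step

end MDP

/-! ## Reasoning about programs -/

namespace Symbolic

/-! ### Frame conditions -/

section Frame

variable {V : Type*}

/-- `τ` arises from `σ` by changing at most the numbers at addresses in `N` and the vertex sets at
addresses in `W`, which is confined to the fixed registers. -/
structure Frame (N W : ℕ → Prop) (σ τ : State V) : Prop where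
  num : ∀ a, ¬ N a → τ.num a = σ.num a
  vert : ∀ a, ¬ W a → τ.vert a = σ.vert a
  edge : τ.edge = σ.edge
  out : τ.out = σ.out
  vertRegs : τ.vertRegs ≤ max σ.vertRegs 11
  edgeRegs : τ.edgeRegs = σ.edgeRegs

theorem Frame.refl (N W : ℕ → Prop) (σ : State V) : Frame N W σ σ :=
  ⟨fun _ _ => rfl, fun _ _ => rfl, rfl, rfl, le_max_left _ _, rfl⟩

theorem Frame.trans {N W : ℕ → Prop} {σ τ υ : State V} (h : Frame N W σ τ) (h' : Frame N W τ υ) :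
    Frame N W σ υ where
  num a ha := (h'.num a ha).trans (h.num a ha)
  vert a ha := (h'.vert a ha).trans (h.vert a ha)
  edge := h'.edge.trans h.edge
  out := h'.out.trans h.out
  vertRegs := h'.vertRegs.trans (max_le h.vertRegs (le_max_right _ _))
  edgeRegs := h'.edgeRegs.trans h.edgeRegs

theorem Frame.mono {N W N' W' : ℕ → Prop} {σ τ : State V} (h : Frame N W σ τ)
    (hN : ∀ a, N a → N' a) (hW : ∀ a, W a → W' a) : Frame N' W' σ τ where
  num a ha := h.num a fun h0 => ha (hN a h0)
  vert a ha := h.vert a fun h0 => ha (hW a h0)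
  edge := h.edge
  out := h.out
  vertRegs := h.vertRegs
  edgeRegs := h.edgeRegs

/-- Executing instructions leaves a state written as a record of updates. The default arguments
check by `omega` that every updated address is allowed, so chains of updates need no frame lemmas of
their own. The operation count is left arbitrary. -/
theorem Frame.extend {N W : ℕ → Prop} {σ τ : State V} (h : Frame N W σ τ) {num : ℕ → ℕ}
    {vert : ℕ → Finset V} {ops vertRegs : ℕ}
    (hnum : ∀ a, ¬ N a → num a = τ.num a := by
      intro a ha
      beta_reduce at ha
      first
      | rfl
      | (simp only [State.setNum, Function.update_apply]
         split_ifs <;> first | omega | rfl))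
    (hvert : ∀ a, ¬ W a → vert a = τ.vert a := by
      intro a ha
      beta_reduce at ha
      first
      | rfl
      | (simp only [State.setNum, Function.update_apply]
         split_ifs <;> first | omega | rfl))
    (hregs : vertRegs ≤ max τ.vertRegs 11 := by first | omega | simp) :
    Frame N W σ ⟨num, vert, τ.edge, τ.out, ops, vertRegs, τ.edgeRegs⟩ :=
  h.trans ⟨hnum, hvert, rfl, rfl, hregs, rfl⟩

end Frame

/-! ### Rules for total correctness -/

variable {V : Type*} [Fintype V] [DecidableEq V] {choice : ℕ → Finset V → V}

/-- Started in `σ`, the statement `s` terminates in a state that satisfies `Q`. -/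
def Runs (choice : ℕ → Finset V → V) (s : Stmt) (σ : State V) (Q : State V → Prop) : Prop :=
  ∃ τ, Exec choice [] s σ τ ∧ Q τ

theorem Runs.mono {s : Stmt} {σ : State V} {Q Q' : State V → Prop} (h : Runs choice s σ Q)
    (hQ : ∀ τ, Q τ → Q' τ) : Runs choice s σ Q' :=
  let ⟨τ, h1, h2⟩ := h
  ⟨τ, h1, hQ τ h2⟩

theorem runs_skip {σ : State V} {Q : State V → Prop} : Runs choice .skip σ Q ↔ Q σ :=
  ⟨fun ⟨_, h, hQ⟩ => by cases h; exact hQ, fun h => ⟨σ, .skip σ, h⟩⟩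

theorem runs_assign {d e : NExp} {σ : State V} {Q : State V → Prop} :
    Runs choice (.assign d e) σ Q ↔ Q (σ.setNum (d.eval σ.num) (e.eval σ.num)) :=
  ⟨fun ⟨_, h, hQ⟩ => by cases h; exact hQ, fun h => ⟨_, .assign d e σ, h⟩⟩

theorem runs_sym {i : Instr} {σ : State V} {Q : State V → Prop} :
    Runs choice (.sym i) σ Q ↔ Q (i.step choice σ) :=
  ⟨fun ⟨_, h, hQ⟩ => by cases h; exact hQ, fun h => ⟨_, .sym i σ, h⟩⟩

theorem runs_seq {s t : Stmt} {σ : State V} {Q : State V → Prop} :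
    Runs choice (.seq s t) σ Q ↔ Runs choice s σ fun τ => Runs choice t τ Q :=
  ⟨fun ⟨_, h, hQ⟩ => by cases h with | seq h1 h2 => exact ⟨_, h1, _, h2, hQ⟩,
    fun ⟨_, h1, _, h2, hQ⟩ => ⟨_, .seq h1 h2, hQ⟩⟩

theorem runs_ite {c : NExp} {s t : Stmt} {σ : State V} {Q : State V → Prop} :
    Runs choice (.ite c s t) σ Q ↔
      (c.eval σ.num ≠ 0 → Runs choice s σ Q) ∧ (c.eval σ.num = 0 → Runs choice t σ Q) := by
  constructor
  · rintro ⟨_, h, hQ⟩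
    cases h with
    | ite_true hc h => exact ⟨fun _ => ⟨_, h, hQ⟩, fun h0 => absurd h0 hc⟩
    | ite_false hc h => exact ⟨fun h0 => absurd hc h0, fun _ => ⟨_, h, hQ⟩⟩
  · rintro ⟨h1, h2⟩
    by_cases hc : c.eval σ.num = 0
    · obtain ⟨τ, h, hQ⟩ := h2 hc
      exact ⟨τ, .ite_false hc h, hQ⟩
    · obtain ⟨τ, h, hQ⟩ := h1 hc
      exact ⟨τ, .ite_true hc h, hQ⟩

/-- The loop rule, with an invariant `I` and a variant `m`. -/
theorem runs_loop {c : NExp} {s : Stmt} {Q : State V → Prop} (I : State V → Prop)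
    (m : State V → ℕ)
    (step : ∀ σ, I σ → c.eval σ.num ≠ 0 → Runs choice s σ fun τ => I τ ∧ m τ < m σ)
    (exit : ∀ σ, I σ → c.eval σ.num = 0 → Q σ) {σ : State V} (h : I σ) :
    Runs choice (.loop c s) σ Q := by
  induction hk : m σ using Nat.strong_induction_on generalizing σ with
  | _ k ih =>
    by_cases hc : c.eval σ.num = 0
    · exact ⟨σ, .loop_false hc, exit σ h hc⟩
    · obtain ⟨τ, h1, h2, h3⟩ := step σ h hc
      obtain ⟨υ, h4, h5⟩ := ih _ (hk ▸ h3) h2 rfl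
      exact ⟨υ, .loop_true hc h1 h4, h5⟩

end Symbolic

/-! ## Building blocks of programs -/

namespace Symbolic

attribute [simp] runs_skip runs_assign runs_sym runs_seq runs_ite NExp.eval Instr.step Instr.effect
  State.setNum State.setVert SetOp.eval SetTest.eval

instance : Add NExp := ⟨.add⟩
instance : Sub NExp := ⟨.sub⟩
instance : Mul NExp := ⟨.mul⟩
instance : Div NExp := ⟨.div⟩

/-- The content of a fixed numeric register. -/
def x (k : ℕ) : NExp := .reg (.const k)

/-- A numeral. -/
def lit (k : ℕ) : NExp := .const k

@[simp] theorem eval_x (m : ℕ → ℕ) (k : ℕ) : (x k).eval m = m k := rfl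
@[simp] theorem eval_lit (m : ℕ → ℕ) (k : ℕ) : (lit k).eval m = k := rfl
@[simp] theorem eval_add (m : ℕ → ℕ) (e f : NExp) : (e + f).eval m = e.eval m + f.eval m := rfl
@[simp] theorem eval_sub (m : ℕ → ℕ) (e f : NExp) : (e - f).eval m = e.eval m - f.eval m := rfl
@[simp] theorem eval_mul (m : ℕ → ℕ) (e f : NExp) : (e * f).eval m = e.eval m * f.eval m := rfl
@[simp] theorem eval_div (m : ℕ → ℕ) (e f : NExp) : (e / f).eval m = e.eval m / f.eval m := rfl

/-- Sequential composition. -/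
def block : List Stmt → Stmt
  | [] => .skip
  | s :: l => .seq s (block l)

/-! ### The layout of the memory

Numeric registers: `1` the number `n` of vertices, `2` the number of bits of a vertex number, `3` a
threshold, `4` the number of undecided vertices at the last refresh, `5` the current one, `6` a
vertex number plus one or zero; the arrays start at `16`, all others are scratch. Vertex registers:
`0` all vertices, `2` random vertices, `3` undecided vertices, `9` vertices in no MEC; `11 + i` the
vertices whose number has bit `i`; all others are scratch. -/

/-- The state of the vertex `i`: `0` undecided, `1` undecided with known successors, `2` decided. -/
def stExp (i : NExp) : NExp := lit 16 + lit 3 * i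

/-- A mark of the vertex `i`. -/
def visExp (i : NExp) : NExp := lit 17 + lit 3 * i

/-- Whether there is a known edge from `i` to `j`. -/
def adjExp (i j : NExp) : NExp := lit 18 + lit 3 * (i * x 1 + j)

@[simp] theorem eval_stExp (m : ℕ → ℕ) (i : NExp) : (stExp i).eval m = 16 + 3 * i.eval m := rfl
@[simp] theorem eval_visExp (m : ℕ → ℕ) (i : NExp) : (visExp i).eval m = 17 + 3 * i.eval m := rfl
@[simp] theorem eval_adjExp (m : ℕ → ℕ) (i j : NExp) :
    (adjExp i j).eval m = 18 + 3 * (i.eval m * m 1 + j.eval m) := rfl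

section Numbering

variable {V : Type*} [Fintype V]

/-- `idx` numbers the vertices, with numbers of `L` bits. -/
structure Numbering (L : ℕ) (idx : V → ℕ) : Prop where
  inj : Function.Injective idx
  lt : ∀ v, idx v < Fintype.card V
  le_pow : Fintype.card V ≤ 2 ^ L

/-- An injection into a finite set of the same size is surjective. Loops over numbers therefore are
loops over vertices. -/
theorem Numbering.exists_eq {L : ℕ} {idx : V → ℕ} (hn : Numbering L idx) {i : ℕ}
    (hi : i < Fintype.card V) : ∃ v, idx v = i := by
  let f : V → Fin (Fintype.card V) := fun v => ⟨idx v, hn.lt v⟩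
  have hf : Function.Injective f := fun a b h => hn.inj (by simpa [f] using h)
  have hb := (Fintype.bijective_iff_injective_and_card f).2 ⟨hf, by simp⟩
  obtain ⟨v, hv⟩ := hb.2 ⟨i, hi⟩
  exact ⟨v, by simpa [f] using hv⟩

end Numbering

variable {V : Type*} [Fintype V] [DecidableEq V] {choice : ℕ → Finset V → V}

/-- The part of the memory that stays fixed. -/
structure Env (P : MDP V) (L h : ℕ) (idx : V → ℕ) (σ : State V) : Prop where
  card : σ.num 1 = Fintype.card V
  bits : σ.num 2 = L
  thr : σ.num 3 = h
  edge : σ.edge 0 = P.edges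
  random : σ.vert 2 = P.random
  bit : ∀ i < L, ∀ v, v ∈ σ.vert (11 + i) ↔ (idx v).testBit i = true
  vertRegs : σ.vertRegs ≤ 11 + L
  edgeRegs : σ.edgeRegs = 1

/-- The bounds on `N` and `W` spare the numeric registers 1 to 3, the random vertices in vertex
register 2 and the bit sets from 11 on. -/
theorem Env.of_frame {P : MDP V} {L h : ℕ} {idx : V → ℕ} {σ τ : State V} {N W : ℕ → Prop}
    (hE : Env P L h idx σ) (hF : Frame N W σ τ) (hN : ∀ a, N a → 4 ≤ a)
    (hW : ∀ a, W a → 3 ≤ a ∧ a ≤ 10) : Env P L h idx τ where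
  card := by rw [hF.num 1 fun h => by have := hN _ h; omega, hE.card]
  bits := by rw [hF.num 2 fun h => by have := hN _ h; omega, hE.bits]
  thr := by rw [hF.num 3 fun h => by have := hN _ h; omega, hE.thr]
  edge := by rw [hF.edge, hE.edge]
  random := by rw [hF.vert 2 fun h => by have := hW _ h; omega, hE.random]
  bit i hi v := by rw [hF.vert (11 + i) fun h => by have := hW _ h; omega, hE.bit i hi]
  vertRegs := by have := hF.vertRegs; have := hE.vertRegs; omega
  edgeRegs := by rw [hF.edgeRegs, hE.edgeRegs]

/-- Puts the number of the vertex in register `4` into the numeric register `10`. -/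
def identify : Stmt := block [
  .assign (lit 10) (lit 0),
  .assign (lit 11) (lit 0),
  .assign (lit 12) (lit 1),
  .loop (x 2 - x 11) (block [
    .sym (.vertTest .subset (lit 13) (lit 4) (lit 11 + x 11)),
    .assign (lit 10) (x 10 + x 13 * x 12),
    .assign (lit 12) (x 12 * lit 2),
    .assign (lit 11) (x 11 + lit 1)])]

theorem identify_spec {P : MDP V} {L h : ℕ} {idx : V → ℕ} (hn : Numbering L idx) {σ : State V}
    (hE : Env P L h idx σ) {v : V} (hv : σ.vert 4 = {v}) :
    Runs choice identify σ fun τ => Frame (fun a => 10 ≤ a ∧ a ≤ 13) (fun _ => False) σ τ ∧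
      τ.num 10 = idx v ∧ τ.ops = σ.ops + L := by
  simp only [identify, block, runs_seq, runs_assign, runs_skip]
  refine runs_loop (fun τ => Frame (fun a => 10 ≤ a ∧ a ≤ 13) (fun _ => False) σ τ ∧
    τ.num 11 ≤ L ∧ τ.num 10 = idx v % 2 ^ τ.num 11 ∧ τ.num 12 = 2 ^ τ.num 11 ∧
    τ.ops = σ.ops + τ.num 11) (fun τ => L - τ.num 11) ?_ ?_ ?_
  · rintro τ ⟨hF, h1, h2, h3, h4⟩ hc
    have hE' := hE.of_frame hF (by intros; omega) (by simp)
    simp only [eval_sub, eval_x, hE'.bits] at hc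
    have hi : τ.num 11 < L := by omega
    have hv' : τ.vert 4 = {v} := by rw [hF.vert 4 (by simp), hv]
    -- The outcome of the subset test is the next binary digit of the number; register 10
    -- accumulates the digits read so far, that is, `idx v` modulo a power of two.
    have hb : (if v ∈ τ.vert (11 + τ.num 11) then 1 else 0) = idx v / 2 ^ τ.num 11 % 2 := by
      rw [← Nat.toNat_testBit]
      simp only [hE'.bit _ hi v]
      cases (idx v).testBit (τ.num 11) <;> rfl
    simp [hv', hb]
    refine ⟨⟨hF.extend, hi, ?_, ?_, ?_⟩, ?_⟩
    · rw [h2, h3, Nat.mod_pow_succ, mul_comm]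
    · rw [h3, pow_succ]
    · omega
    · omega
  · rintro τ ⟨hF, h1, h2, h3, h4⟩ hc
    have hE' := hE.of_frame hF (by intros; omega) (by simp)
    simp only [eval_sub, eval_x, hE'.bits] at hc
    have hi : τ.num 11 = L := by omega
    rw [hi] at h2 h4
    exact ⟨hF, by rw [h2, Nat.mod_eq_of_lt ((hn.lt v).trans_le hn.le_pow)], h4⟩
  · simp [Nat.mod_one]
    exact (Frame.refl _ _ σ).extend

/-- Stores the undecided vertex whose number plus one is in the numeric register `6` in
register `4`. -/
def select : Stmt := block [
  .assign (lit 13) (x 6 - lit 1),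
  .assign (lit 11) (lit 0),
  .sym (.vertOp .union (lit 4) (lit 3) (lit 3)),
  .loop (x 2 - x 11) (block [
    .ite (x 13 - lit 2 * (x 13 / lit 2))
      (.sym (.vertOp .inter (lit 4) (lit 4) (lit 11 + x 11)))
      (.sym (.vertOp .diff (lit 4) (lit 4) (lit 11 + x 11))),
    .assign (lit 13) (x 13 / lit 2),
    .assign (lit 11) (x 11 + lit 1)])]

theorem select_spec {P : MDP V} {L h : ℕ} {idx : V → ℕ} (hn : Numbering L idx) {σ : State V}
    (hE : Env P L h idx σ) {v : V} (hv : v ∈ σ.vert 3) (h6 : σ.num 6 = idx v + 1) :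
    Runs choice select σ fun τ => Frame (fun a => 10 ≤ a ∧ a ≤ 13) (fun a => a = 4) σ τ ∧
      τ.vert 4 = {v} ∧ τ.ops = σ.ops + (L + 1) := by
  simp only [select, block, runs_seq, runs_assign, runs_skip, runs_sym]
  refine runs_loop (fun τ => Frame (fun a => 10 ≤ a ∧ a ≤ 13) (fun a => a = 4) σ τ ∧
    τ.num 11 ≤ L ∧ τ.num 13 = idx v / 2 ^ τ.num 11 ∧
    (∀ w, w ∈ τ.vert 4 ↔ w ∈ σ.vert 3 ∧
      ∀ k < τ.num 11, (idx w).testBit k = (idx v).testBit k) ∧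
    τ.ops = σ.ops + (τ.num 11 + 1)) (fun τ => L - τ.num 11) ?_ ?_ ?_
  · rintro τ ⟨hF, h1, h2, h3, h4⟩ hc
    have hE' := hE.of_frame hF (by intros; omega) (by intros; omega)
    simp only [eval_sub, eval_x, hE'.bits] at hc
    have hi : τ.num 11 < L := by omega
    have hb : ((idx v).testBit (τ.num 11)).toNat = τ.num 13 % 2 := by
      rw [Nat.toNat_testBit, h2]
    have hbit := hE'.bit _ hi
    -- The expressions of the machine have no remainder, so parity is computed by division.
    have hm : τ.num 13 - 2 * (τ.num 13 / 2) = τ.num 13 % 2 := by omega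
    have hstep : ∀ w, (w ∈ σ.vert 3 ∧
        ∀ k ≤ τ.num 11, (idx w).testBit k = (idx v).testBit k) ↔
        w ∈ τ.vert 4 ∧ (idx w).testBit (τ.num 11) = (idx v).testBit (τ.num 11) := by
      intro w
      rw [h3 w, and_assoc]
      refine and_congr_right fun _ => ?_
      constructor
      · exact fun h => ⟨fun k hk => h k (by omega), h _ (by omega)⟩
      · rintro ⟨h5, h6⟩ k hk
        rcases hk.lt_or_eq with hk | rfl
        · exact h5 k hk
        · exact h6
    have hdiv : τ.num 13 / 2 = idx v / 2 ^ (τ.num 11 + 1) := by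
      rw [h2, Nat.div_div_eq_div_mul, pow_succ]
    simp only [runs_seq, runs_ite, runs_assign, runs_skip, runs_sym]
    constructor
    · intro hc2
      simp [hm] at hc2
      have hb' : (idx v).testBit (τ.num 11) = true := by
        cases hh : (idx v).testBit (τ.num 11)
        · simp [hh] at hb; omega
        · rfl
      simp [hdiv, hbit, hstep, hb']
      exact ⟨⟨hF.extend, hi, by omega⟩, by omega⟩
    · intro hc2
      simp [hm] at hc2
      have hb' : (idx v).testBit (τ.num 11) = false := by
        cases hh : (idx v).testBit (τ.num 11)
        · rfl
        · simp [hh] at hb; omega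
      simp [hdiv, hbit, hstep, hb']
      exact ⟨⟨hF.extend, hi, by omega⟩, by omega⟩
  · rintro τ ⟨hF, h1, h2, h3, h4⟩ hc
    have hE' := hE.of_frame hF (by intros; omega) (by intros; omega)
    simp only [eval_sub, eval_x, hE'.bits] at hc
    have hi : τ.num 11 = L := by omega
    rw [hi] at h3 h4
    refine ⟨hF, ?_, h4⟩
    ext w
    rw [h3, Finset.mem_singleton]
    constructor
    · rintro ⟨-, hw⟩
      -- Agreement on the lowest `L` bits suffices, since all numbers are below `2 ^ L`.
      refine hn.inj (Nat.eq_of_testBit_eq fun k => ?_)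
      by_cases hk : k < L
      · exact hw k hk
      · have : ∀ u, (idx u).testBit k = false := fun u => Nat.testBit_lt_two_pow
          (((hn.lt u).trans_le hn.le_pow).trans_le (Nat.pow_le_pow_right (by omega) (by omega)))
        rw [this, this]
    · rintro rfl
      exact ⟨hv, fun _ _ => rfl⟩
  · simp [h6]
    exact (Frame.refl _ _ σ).extend

end Symbolic

/-! ## Symbolic search for bottom components -/

namespace Symbolic

set_option linter.unusedSimpArgs false
set_option linter.flexible false

variable {V : Type*} [Fintype V] [DecidableEq V] {choice : ℕ → Finset V → V}

/-- Stores the vertices that are reachable from the vertex in register `4` among the undecided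
vertices in register `7`. -/
def component : Stmt := block [
  .sym (.vertOp .union (lit 7) (lit 4) (lit 4)),
  .sym (.vertOp .union (lit 8) (lit 4) (lit 4)),
  .sym (.card (lit 9) (lit 8)),
  .loop (x 9) (block [
    .sym (.post (lit 8) (lit 0) (lit 8)),
    .sym (.vertOp .inter (lit 8) (lit 8) (lit 3)),
    .sym (.vertOp .diff (lit 8) (lit 8) (lit 7)),
    .sym (.vertOp .union (lit 7) (lit 7) (lit 8)),
    .sym (.card (lit 9) (lit 8))])]

/-- Forward breadth-first search with the frontier in register 8. The five operations of a round are
charged to its non-empty frontier, and a vertex is in the frontier once only. The cost is thus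
linear in the component, not in `A`. -/
theorem component_spec {P : MDP V} {L h : ℕ} {idx : V → ℕ} {σ : State V}
    (hE : Env P L h idx σ) {A : Finset V} (hA : σ.vert 3 = A) {r : V} (hrA : r ∈ A)
    (hr : σ.vert 4 = {r}) :
    Runs choice component σ fun τ => Frame (fun a => a = 9) (fun a => a = 7 ∨ a = 8) σ τ ∧
      (∀ w, w ∈ τ.vert 7 ↔ P.Reach A r w) ∧ τ.ops ≤ σ.ops + 3 + 5 * (τ.vert 7).card := by
  simp only [component, block, runs_seq, runs_skip, runs_sym]
  refine runs_loop (fun τ => Frame (fun a => a = 9) (fun a => a = 7 ∨ a = 8) σ τ ∧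
    τ.num 9 = (τ.vert 8).card ∧ r ∈ τ.vert 7 ∧ (∀ w ∈ τ.vert 7, P.Reach A r w) ∧
    (∀ u ∈ τ.vert 7, u ∉ τ.vert 8 → ∀ w ∈ A, (u, w) ∈ P.edges → w ∈ τ.vert 7) ∧
    τ.ops + 5 * (τ.vert 8).card ≤ σ.ops + 3 + 5 * (τ.vert 7).card ∧ τ.vert 8 ⊆ τ.vert 7)
    (fun τ => 2 * (Fintype.card V - (τ.vert 7).card) + (τ.vert 8).card) ?_ ?_ ?_
  · rintro τ ⟨hF, h9, hr7, hreach, hcl, hops, hsub⟩ hc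
    have hE' := hE.of_frame hF (by intros; omega) (by intros; omega)
    have hA' : τ.vert 3 = A := by rw [hF.vert 3 (by omega), hA]
    simp only [eval_x, h9] at hc
    simp only [runs_seq, runs_sym, runs_assign, runs_skip, Instr.step, Instr.effect, State.setNum,
      State.setVert, SetOp.eval, eval_lit, eval_x, Function.update_self, Function.update_of_ne,
      ne_eq, Nat.reduceEqDiff, not_false_eq_true, hA', hE'.edge]
    generalize hG : (post P.edges (τ.vert 8) ∩ A) \ τ.vert 7 = G
    have hG' : ∀ w, w ∈ G ↔ ((∃ u ∈ τ.vert 8, (u, w) ∈ P.edges) ∧ w ∈ A) ∧ w ∉ τ.vert 7 := by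
      intro w; rw [← hG]; simp [post]
    have hdisj : Disjoint (τ.vert 7) G :=
      Finset.disjoint_left.2 fun w hw hwG => ((hG' w).1 hwG).2 hw
    have hcard := Finset.card_union_of_disjoint hdisj
    have hle := Finset.card_le_univ (τ.vert 7 ∪ G)
    refine ⟨⟨hF.extend, trivial, Finset.mem_union_left _ hr7, ?_, ?_, ?_,
      Finset.subset_union_right⟩, ?_⟩
    · intro w hw
      rcases Finset.mem_union.1 hw with hw | hw
      · exact hreach w hw
      · obtain ⟨⟨⟨u, hu, huw⟩, hwA⟩, -⟩ := (hG' w).1 hw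
        have hu' := hreach u (hsub hu)
        exact hu'.tail ⟨hu'.mem hrA, hwA, huw⟩
    · intro u hu huG w hwA huw
      rw [Finset.mem_union] at hu ⊢
      by_cases hw7 : w ∈ τ.vert 7
      · exact Or.inl hw7
      · rcases hu with hu | hu
        · by_cases hu8 : u ∈ τ.vert 8
          · exact Or.inr ((hG' w).2 ⟨⟨⟨u, hu8, huw⟩, hwA⟩, hw7⟩)
          · exact Or.inl (hcl u hu hu8 w hwA huw)
        · exact absurd hu huG
    · omega
    · omega
  · rintro τ ⟨hF, h9, hr7, hreach, hcl, hops, hsub⟩ hc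
    simp only [eval_x, h9, Finset.card_eq_zero] at hc
    refine ⟨hF, fun w => ⟨hreach w, fun hw => ?_⟩, by omega⟩
    induction hw with
    | refl => exact hr7
    | tail _ h ih => exact hcl _ ih (by simp [hc]) _ h.2.1 h.2.2
  · simp [hr]
    exact ⟨(Frame.refl _ _ σ).extend, .refl⟩

/-- Removes the bottom component in register `7` and the random vertices that can leave the rest;
all of these vertices are stored in register `10`. -/
def removeComponent : Stmt := block [
  .sym (.vertOp .diff (lit 3) (lit 3) (lit 7)),
  .sym (.vertOp .union (lit 10) (lit 7) (lit 7)),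
  .sym (.vertOp .union (lit 8) (lit 7) (lit 7)),
  .sym (.card (lit 9) (lit 8)),
  .loop (x 9) (block [
    .sym (.pre (lit 8) (lit 0) (lit 8)),
    .sym (.vertOp .inter (lit 8) (lit 8) (lit 3)),
    .sym (.vertOp .inter (lit 8) (lit 8) (lit 2)),
    .sym (.vertOp .diff (lit 3) (lit 3) (lit 8)),
    .sym (.vertOp .union (lit 9) (lit 9) (lit 8)),
    .sym (.vertOp .union (lit 10) (lit 10) (lit 8)),
    .sym (.card (lit 9) (lit 8))])]

/-- In the invariant, `S` collects the random vertices removed along with `C`. A MEC other than `C`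
that contained a random vertex with an edge into `C ∪ S` would contain the endpoint as well,
although it is disjoint from `C` and `S`. Once the frontier is empty, random edges no longer leave
the rest. The seven operations of a round are charged to its frontier. -/
theorem removeComponent_spec {P : MDP V} {L h : ℕ} {idx : V → ℕ} {σ : State V}
    (hE : Env P L h idx σ) {A R C : Finset V} {out : List (Finset V)} {r : V}
    (hP : P.Partial A R out) (hr : P.IsRoot A r) (hC : ∀ w, w ∈ C ↔ P.Reach A r w)
    (h3 : σ.vert 3 = A) (h7 : σ.vert 7 = C) (h9 : σ.vert 9 = R) :
    Runs choice removeComponent σ fun τ =>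
      Frame (fun a => a = 9) (fun a => a = 3 ∨ a = 8 ∨ a = 9 ∨ a = 10) σ τ ∧
      P.Partial (τ.vert 3) (τ.vert 9) (out ++ [C]) ∧ τ.vert 3 ⊆ A ∧ τ.vert 10 = A \ τ.vert 3 ∧
      C ⊆ τ.vert 10 ∧ τ.ops ≤ σ.ops + 4 + 7 * (τ.vert 10).card := by
  have hCA : C ⊆ A := fun w hw => ((hC w).1 hw).mem hr.1
  simp only [removeComponent, block, runs_seq, runs_skip, runs_sym]
  refine runs_loop (fun τ =>
    Frame (fun a => a = 9) (fun a => a = 3 ∨ a = 8 ∨ a = 9 ∨ a = 10) σ τ ∧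
    τ.num 9 = (τ.vert 8).card ∧ ∃ S : Finset V, S ⊆ A ∧ Disjoint S C ∧
    τ.vert 3 = (A \ C) \ S ∧ τ.vert 9 = R ∪ S ∧ τ.vert 10 = C ∪ S ∧
    (∀ X, P.IsMEC X → X ⊆ A → X ≠ C → Disjoint X S) ∧
    (τ.vert 8 ⊆ C ∪ S) ∧
    (∀ v ∈ (A \ C) \ S, v ∈ P.random → ∀ w, (v, w) ∈ P.edges →
      w ∈ (A \ C) \ S ∨ w ∈ τ.vert 8) ∧
    τ.ops + 7 * (τ.vert 8).card ≤ σ.ops + 4 + 7 * (C ∪ S).card)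
    (fun τ => 2 * (τ.vert 3).card + (τ.vert 8).card) ?_ ?_ ?_
  · rintro τ ⟨hF, hn9, S, hSA, hSC, h3', h9', h10', hmec, h8, hcl, hops⟩ hc
    have hE' := hE.of_frame hF (by intros; omega) (by intros; omega)
    simp only [eval_x, hn9] at hc
    simp only [runs_seq, runs_sym, runs_assign, runs_skip, Instr.step, Instr.effect, State.setNum,
      State.setVert, SetOp.eval, eval_lit, eval_x, Function.update_self, Function.update_of_ne,
      ne_eq, Nat.reduceEqDiff, not_false_eq_true, h3', h9', h10', hE'.edge, hE'.random]
    generalize hG : pre P.edges (τ.vert 8) ∩ ((A \ C) \ S) ∩ P.random = G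
    have hG' : ∀ w, w ∈ G ↔ ((∃ u ∈ τ.vert 8, (w, u) ∈ P.edges) ∧ w ∈ (A \ C) \ S) ∧
        w ∈ P.random := by
      intro w; rw [← hG]; simp only [pre, Finset.mem_inter, Finset.mem_filter, Finset.mem_univ,
        true_and]
    have hGsub : G ⊆ (A \ C) \ S := fun w hw => ((hG' w).1 hw).1.2
    have hGA : ∀ w ∈ G, w ∈ A ∧ w ∉ C ∧ w ∉ S := fun w hw => by
      have := hGsub hw
      simp only [Finset.mem_sdiff] at this
      tauto
    have hcard1 := Finset.card_sdiff_add_card_eq_card hGsub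
    have hdisj : Disjoint (C ∪ S) G := Finset.disjoint_left.2 fun w hw hwG => by
      have := hGA w hwG
      simp only [Finset.mem_union] at hw
      tauto
    have hcard2 := Finset.card_union_of_disjoint hdisj
    refine ⟨⟨hF.extend, trivial, S ∪ G, ?_, ?_, ?_, ?_, ?_, ?_, ?_, ?_, ?_⟩, ?_⟩
    · exact Finset.union_subset hSA fun w hw => (hGA w hw).1
    · rw [Finset.disjoint_union_left]
      exact ⟨hSC, Finset.disjoint_left.2 fun w hw => (hGA w hw).2.1⟩
    · ext w; simp; tauto
    · rw [Finset.union_assoc]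
    · rw [Finset.union_assoc]
    · intro X hX hXA hXC
      rw [Finset.disjoint_union_right]
      refine ⟨hmec X hX hXA hXC, Finset.disjoint_left.2 fun w hw hwG => ?_⟩
      obtain ⟨⟨⟨u, hu, hwu⟩, -⟩, hwr⟩ := (hG' w).1 hwG
      have huX := hX.1.2.2 w hw hwr u hwu
      rcases Finset.mem_union.1 (h8 hu) with hu | hu
      · exact Finset.disjoint_left.1 (hP.disjoint_of_ne hr hC hX hXA hXC) huX hu
      · exact Finset.disjoint_left.1 (hmec X hX hXA hXC) huX hu
    · intro w hw; simp [hw]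
    · intro v hvS hvr w hvw
      have hv : v ∈ (A \ C) \ S := by simp at hvS ⊢; tauto
      have hvG : v ∉ G := by simp at hvS; tauto
      by_cases hwG : w ∈ G
      · exact Or.inr hwG
      · rcases hcl v hv hvr w hvw with hw | hw
        · left; simp at hw ⊢; tauto
        · exact absurd ((hG' v).2 ⟨⟨⟨w, hw, hvw⟩, hv⟩, hvr⟩) hvG
    · rw [← Finset.union_assoc, hcard2]; omega
    · omega
  · rintro τ ⟨hF, hn9, S, hSA, hSC, h3', h9', h10', hmec, h8, hcl, hops⟩ hc
    simp only [eval_x, hn9, Finset.card_eq_zero] at hc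
    rw [h3', h9', h10']
    refine ⟨hF, hP.remove hr hC hSA hSC hmec fun v hv hvr w hw => ?_, ?_, ?_, ?_, by omega⟩
    · exact (hcl v hv hvr w hw).resolve_right (by simp [hc])
    · exact Finset.sdiff_subset.trans Finset.sdiff_subset
    · ext w
      have h1 := @hSA w
      have h2 := @hCA w
      simp
      tauto
    · exact Finset.subset_union_left
  · simp [h3, h7, h9]
    refine ⟨(Frame.refl _ _ σ).extend, ∅, ?_⟩
    simp
    intro v hvA hvC hvr w hw
    by_cases hwC : w ∈ C
    · exact Or.inr hwC
    · exact Or.inl ⟨hP.closed v hvA hvr w hw, hwC⟩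

/-- Stores a vertex of a bottom component of the undecided vertices in register `4`. -/
def searchRoot : Stmt := block [
  .sym (.vertOp .union (lit 5) (lit 3) (lit 3)),
  .sym (.card (lit 8) (lit 5)),
  .loop (x 8) (block [
    .sym (.pick (lit 4) (lit 5)),
    .sym (.vertOp .union (lit 8) (lit 4) (lit 4)),
    .sym (.vertOp .diff (lit 5) (lit 5) (lit 4)),
    .sym (.card (lit 9) (lit 8)),
    .loop (x 9) (block [
      .sym (.pre (lit 8) (lit 0) (lit 8)),
      .sym (.vertOp .inter (lit 8) (lit 8) (lit 5)),
      .sym (.vertOp .diff (lit 5) (lit 5) (lit 8)),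
      .sym (.card (lit 9) (lit 8))]),
    .sym (.card (lit 8) (lit 5))])]

/-- Register 5 holds the uncovered vertices; a picked vertex covers all uncovered vertices that
reach it. The covered set is closed under predecessors in `A` after each pick, so the last pick lies
in a bottom component by `isRoot_of_pre_closed`. In the bound, a covered vertex pays four operations
for a round of the inner loop and five for one of the outer loop. -/
theorem searchRoot_spec (hch : ∀ t X, X.Nonempty → choice t X ∈ X)
    {P : MDP V} {L h : ℕ} {idx : V → ℕ} {σ : State V}
    (hE : Env P L h idx σ) {A : Finset V} (hA : σ.vert 3 = A) (hne : A.Nonempty) :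
    Runs choice searchRoot σ fun τ =>
      Frame (fun a => a = 8 ∨ a = 9) (fun a => a = 4 ∨ a = 5 ∨ a = 8) σ τ ∧
      (∃ r, τ.vert 4 = {r} ∧ P.IsRoot A r) ∧ τ.ops ≤ σ.ops + 2 + 9 * A.card := by
  simp only [searchRoot, block, runs_seq, runs_skip, runs_sym]
  refine runs_loop (fun τ =>
    Frame (fun a => a = 8 ∨ a = 9) (fun a => a = 4 ∨ a = 5 ∨ a = 8) σ τ ∧
    τ.num 8 = (τ.vert 5).card ∧ τ.vert 5 ⊆ A ∧
    (∀ a ∈ A, ∀ b ∈ A, (a, b) ∈ P.edges → b ∉ τ.vert 5 → a ∉ τ.vert 5) ∧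
    τ.ops + 9 * (τ.vert 5).card ≤ σ.ops + 2 + 9 * A.card ∧
    (τ.vert 5 = A ∨ ∃ r ∈ A, τ.vert 4 = {r} ∧ ∃ p : V → Prop,
      (∀ a ∈ A, ∀ b ∈ A, (a, b) ∈ P.edges → p b → p a) ∧ ¬ p r ∧
      ∀ v ∈ A, v ∉ τ.vert 5 → p v ∨ P.Reach A v r))
    (fun τ => (τ.vert 5).card) ?_ ?_ ?_
  · rintro σ₁ ⟨hF₁, hn8, hsub, hcl, hops, -⟩ hc
    simp only [eval_x, hn8] at hc
    have hne5 : (σ₁.vert 5).Nonempty := Finset.card_ne_zero.1 hc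
    set T := σ₁.vert 5 with hT
    set r := choice σ₁.ops T
    have hrT : r ∈ T := hch _ _ hne5
    have hTc : 0 < T.card := Finset.card_pos.2 hne5
    simp only [runs_seq, runs_sym]
    refine runs_loop (fun τ =>
      Frame (fun a => a = 8 ∨ a = 9) (fun a => a = 4 ∨ a = 5 ∨ a = 8) σ₁ τ ∧
      τ.num 9 = (τ.vert 8).card ∧ τ.vert 4 = {r} ∧ τ.vert 5 ⊆ T ∧ r ∉ τ.vert 5 ∧
      (∀ v ∈ T, v ∉ τ.vert 5 → P.Reach A v r) ∧ τ.vert 8 ⊆ T ∧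
      (∀ v ∈ τ.vert 8, v ∉ τ.vert 5) ∧
      (∀ a ∈ A, ∀ b ∈ A, (a, b) ∈ P.edges → b ∉ τ.vert 5 → b ∉ τ.vert 8 → a ∉ τ.vert 5) ∧
      τ.ops + 4 * (τ.vert 8).card + 4 * (τ.vert 5).card ≤ σ₁.ops + 4 + 4 * T.card)
      (fun τ => 2 * (τ.vert 5).card + (τ.vert 8).card) ?_ ?_ ?_
    · rintro τ ⟨hF, hn9, h4, h5T, hr5, hreach, h8T, h85, hcl', hops'⟩ hc
      have hE' := hE.of_frame (hF₁.trans hF) (by intros; omega) (by intros; omega)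
      simp only [eval_x, hn9] at hc
      simp only [runs_seq, runs_sym, runs_assign, runs_skip, Instr.step, Instr.effect,
        State.setNum, State.setVert, SetOp.eval, eval_lit, eval_x, Function.update_self,
        Function.update_of_ne, ne_eq, Nat.reduceEqDiff, not_false_eq_true, hE'.edge]
      generalize hG : pre P.edges (τ.vert 8) ∩ τ.vert 5 = G
      have hG' : ∀ w, w ∈ G ↔ (∃ u ∈ τ.vert 8, (w, u) ∈ P.edges) ∧ w ∈ τ.vert 5 := by
        intro w; rw [← hG]; simp [pre]
      have hGsub : G ⊆ τ.vert 5 := fun w hw => ((hG' w).1 hw).2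
      have hcard1 := Finset.card_sdiff_add_card_eq_card hGsub
      refine ⟨⟨hF.extend, trivial, h4, Finset.sdiff_subset.trans h5T,
        fun h => hr5 (Finset.sdiff_subset h), ?_, hGsub.trans h5T,
        fun v hv h => (Finset.mem_sdiff.1 h).2 hv, ?_, ?_⟩, ?_⟩
      · intro v hv hv5
        by_cases hvG : v ∈ G
        · obtain ⟨⟨u, hu, hvu⟩, -⟩ := (hG' v).1 hvG
          exact (hreach u (h8T hu) (h85 u hu)).head ⟨hsub hv, hsub (h8T hu), hvu⟩
        · exact hreach v hv fun h => hv5 (Finset.mem_sdiff.2 ⟨h, hvG⟩)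
      · intro a haA b hbA hab hb5 hbG ha5
        have hb5' : b ∉ τ.vert 5 := fun h => hb5 (Finset.mem_sdiff.2 ⟨h, hbG⟩)
        rw [Finset.mem_sdiff] at ha5
        by_cases hb8 : b ∈ τ.vert 8
        · exact ha5.2 ((hG' a).2 ⟨⟨b, hb8, hab⟩, ha5.1⟩)
        · exact absurd ha5.1 (hcl' a haA b hbA hab hb5' hb8)
      · omega
      · omega
    · rintro τ ⟨hF, hn9, h4, h5T, hr5, hreach, h8T, h85, hcl', hops'⟩ hc
      simp only [eval_x, hn9, Finset.card_eq_zero] at hc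
      have hlt : (τ.vert 5).card < T.card :=
        Finset.card_lt_card ⟨h5T, fun h => hr5 (h hrT)⟩
      simp only [runs_seq, runs_sym, runs_assign, runs_skip, Instr.step, Instr.effect,
        State.setNum, State.setVert, SetOp.eval, eval_lit, eval_x, Function.update_self,
        Function.update_of_ne, ne_eq, Nat.reduceEqDiff, not_false_eq_true]
      refine ⟨⟨(hF₁.trans hF).extend, trivial, h5T.trans hsub, ?_, ?_, Or.inr ⟨r, hsub hrT, h4, ?_⟩⟩, hlt⟩
      · intro a haA b hbA hab hb
        exact hcl' a haA b hbA hab hb (by simp [hc])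
      · simp [hc] at hops'; omega
      -- The predecessor-closed set consists of what was covered before `r` was picked.
      · refine ⟨fun v => v ∉ T, hcl, by simpa using hrT, fun v hvA hv5 => ?_⟩
        by_cases hvT : v ∈ T
        · exact Or.inr (hreach v hvT hv5)
        · exact Or.inl hvT
    · have hcard : (T \ {r}).card + 1 = T.card := by
        rw [Finset.sdiff_singleton_eq_erase]; exact Finset.card_erase_add_one hrT
      simp only [runs_seq, runs_sym, runs_assign, runs_skip, Instr.step, Instr.effect,
        State.setNum, State.setVert, SetOp.eval, eval_lit, eval_x, Function.update_self,
        Function.update_of_ne, ne_eq, Nat.reduceEqDiff, not_false_eq_true, ← hT, if_pos hne5,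
        Finset.union_self]
      refine ⟨(Frame.refl _ _ σ₁).extend, trivial, rfl, Finset.sdiff_subset, by simp [r], ?_,
        by simpa using hrT, by simp [r], ?_, ?_⟩
      · intro v hv hvr
        have : v = r := by simpa [hv] using hvr
        rw [this]
        exact .refl
      · intro a haA b hbA hab hb hbr haT
        have hbT : b ∉ T := fun h => hb (Finset.mem_sdiff.2 ⟨h, hbr⟩)
        exact hcl a haA b hbA hab hbT (Finset.mem_sdiff.1 haT).1
      · simp only [Finset.card_singleton]
        change _ + 4 * (T \ {r}).card ≤ _
        omega
  · rintro τ ⟨hF, hn8, hsub, hcl, hops, hroot⟩ hc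
    simp only [eval_x, hn8, Finset.card_eq_zero] at hc
    refine ⟨hF, ?_, by omega⟩
    rcases hroot with h | ⟨r, hrA, h4, p, hp, hpr, hall⟩
    · rw [← h, hc] at hne
      simp at hne
    · exact ⟨r, h4, MDP.isRoot_of_pre_closed hrA hp hpr fun v hv => hall v hv (by simp [hc])⟩
  · simp [hA]
    exact ⟨(Frame.refl _ _ σ).extend, fun a ha b hb _ h => absurd hb h⟩

end Symbolic

/-! ## Numeric search for bottom components among the known edges -/

namespace Symbolic

set_option linter.unusedSimpArgs false
set_option linter.flexible false

/-! ### Interleaved numeric arrays -/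

section Arrays

variable {V : Type*}

/-- The state of a vertex. -/
def State.st (σ : State V) (idx : V → ℕ) (v : V) : ℕ := σ.num (16 + 3 * idx v)

/-- The mark of a vertex. -/
def State.vis (σ : State V) (idx : V → ℕ) (v : V) : ℕ := σ.num (17 + 3 * idx v)

/-- The matrix of the known edges. -/
def State.adj [Fintype V] (σ : State V) (idx : V → ℕ) (v w : V) : ℕ :=
  σ.num (18 + 3 * (idx v * Fintype.card V + idx w))

end Arrays

section Numbering

variable {V : Type*} [Fintype V]

theorem Numbering.pair_inj {L : ℕ} {idx : V → ℕ} (hn : Numbering L idx) {u v w z : V} :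
    idx u * Fintype.card V + idx w = idx v * Fintype.card V + idx z ↔ u = v ∧ w = z := by
  refine ⟨fun h => ?_, fun h => by rw [h.1, h.2]⟩
  have hpos : 0 < Fintype.card V := (Nat.zero_le _).trans_lt (hn.lt u)
  have h1 : idx u = idx v := by
    have := congrArg (· / Fintype.card V) h
    simpa [Nat.add_comm _ (idx w), Nat.add_comm _ (idx z), Nat.add_mul_div_right _ _ hpos,
      Nat.div_eq_of_lt (hn.lt w), Nat.div_eq_of_lt (hn.lt z)] using this
  rw [h1] at h
  exact ⟨hn.inj h1, hn.inj (by omega)⟩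

theorem Numbering.exists_pair {L : ℕ} {idx : V → ℕ} (hn : Numbering L idx) {e : ℕ}
    (he : e < Fintype.card V * Fintype.card V) :
    ∃ v w, e / Fintype.card V = idx v ∧ e - idx v * Fintype.card V = idx w ∧
      e = idx v * Fintype.card V + idx w := by
  have hpos : 0 < Fintype.card V := Nat.pos_of_ne_zero fun h => by simp [h] at he
  obtain ⟨v, hv⟩ := hn.exists_eq ((Nat.div_lt_iff_lt_mul hpos).2 he)
  obtain ⟨w, hw⟩ := hn.exists_eq (Nat.mod_lt e hpos)
  have h1 := Nat.div_add_mod e (Fintype.card V)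
  rw [← hv, ← hw, mul_comm] at h1
  exact ⟨v, w, hv.symm, by omega, h1.symm⟩

theorem Numbering.pair_lt {L : ℕ} {idx : V → ℕ} (hn : Numbering L idx) (v w : V) :
    idx v * Fintype.card V + idx w < Fintype.card V * Fintype.card V := by
  have h1 : (idx v + 1) * Fintype.card V ≤ Fintype.card V * Fintype.card V :=
    Nat.mul_le_mul_right _ (hn.lt v)
  have h2 := hn.lt w
  rw [add_mul] at h1
  omega

end Numbering

variable {V : Type*} [Fintype V] [DecidableEq V] {choice : ℕ → Finset V → V}

/-- What the arrays say about the MDP, when `A` is the set of the undecided vertices. -/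
structure Known (P : MDP V) (idx : V → ℕ) (A : Finset V) (σ : State V) : Prop where
  le_two : ∀ v, σ.st idx v ≤ 2
  eq_two : ∀ v, σ.st idx v = 2 ↔ v ∉ A
  sound : ∀ v w, σ.adj idx v w ≠ 0 → (v, w) ∈ P.edges
  complete : ∀ v, σ.st idx v = 1 → ∀ w ∈ A, (v, w) ∈ P.edges → σ.adj idx v w ≠ 0

theorem Known.mem {P : MDP V} {idx : V → ℕ} {A : Finset V} {σ : State V} (h : Known P idx A σ)
    {v : V} (hv : σ.st idx v < 2) : v ∈ A := by
  by_contra hvA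
  have := (h.eq_two v).2 hvA
  omega

theorem Known.lt_two {P : MDP V} {idx : V → ℕ} {A : Finset V} {σ : State V} (h : Known P idx A σ)
    {v : V} (hv : v ∈ A) : σ.st idx v < 2 := by
  have h1 := h.le_two v
  have h2 : σ.st idx v ≠ 2 := fun h0 => (h.eq_two v).1 h0 hv
  omega

/-- Marks all the vertices that reach a marked vertex by known edges. -/
def saturate : Stmt := block [
  .assign (lit 14) (lit 0),
  .loop (x 1 * x 1 - x 14) (.ite
    (.reg (lit 18 + lit 3 * x 14) * .reg (visExp (x 14 - x 14 / x 1 * x 1)) *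
      (lit 1 - .reg (visExp (x 14 / x 1))) * (lit 2 - .reg (stExp (x 14 / x 1))))
    (block [
      .assign (visExp (x 14 / x 1)) (lit 1),
      .assign (lit 14) (lit 0)])
    (.assign (lit 14) (x 14 + lit 1)))]

/-- Minimality of the marks is phrased as an induction principle, which lets the caller transfer any
predecessor-closed property to the new marks. Closure under true edges is claimed only in state 1,
where the recorded row is complete. -/
theorem saturate_spec {P : MDP V} {L h : ℕ} {idx : V → ℕ} (hn : Numbering L idx)
    {σ : State V} (hE : Env P L h idx σ) {A : Finset V} (hK : Known P idx A σ)
    (hA : ∀ v, σ.vis idx v ≠ 0 → v ∈ A) :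
    Runs choice saturate σ fun τ =>
      Frame (fun a => a = 14 ∨ (17 ≤ a ∧ a % 3 = 2)) (fun _ => False) σ τ ∧ τ.ops = σ.ops ∧
      (∀ v, σ.vis idx v ≠ 0 → τ.vis idx v ≠ 0) ∧
      (∀ p : V → Prop, (∀ a ∈ A, ∀ b ∈ A, (a, b) ∈ P.edges → p b → p a) →
        (∀ v, σ.vis idx v ≠ 0 → p v) → ∀ v, τ.vis idx v ≠ 0 → p v) ∧
      (∀ v, σ.st idx v = 1 → ∀ w ∈ A, (v, w) ∈ P.edges → τ.vis idx w ≠ 0 → τ.vis idx v ≠ 0) := by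
  simp only [saturate, block, runs_seq, runs_assign, runs_skip]
  refine runs_loop (fun τ =>
    Frame (fun a => a = 14 ∨ (17 ≤ a ∧ a % 3 = 2)) (fun _ => False) σ τ ∧ τ.ops = σ.ops ∧
      (∀ v, σ.vis idx v ≠ 0 → τ.vis idx v ≠ 0) ∧
      (∀ p : V → Prop, (∀ a ∈ A, ∀ b ∈ A, (a, b) ∈ P.edges → p b → p a) →
        (∀ v, σ.vis idx v ≠ 0 → p v) → ∀ v, τ.vis idx v ≠ 0 → p v) ∧
      (∀ v w, idx v * Fintype.card V + idx w < τ.num 14 → v ∈ A → σ.adj idx v w ≠ 0 →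
        τ.vis idx w ≠ 0 → τ.vis idx v ≠ 0))
    -- The order is lexicographic: a new mark resets the position in the matrix to 0, so unmarked
    -- vertices weigh more than a full sweep.
    (fun τ => (Finset.univ.filter fun v => τ.vis idx v = 0).card *
      (Fintype.card V * Fintype.card V + 1) + (Fintype.card V * Fintype.card V - τ.num 14)) ?_ ?_ ?_
  · rintro τ ⟨hF, hops, hmono, hp, hdone⟩ hc
    have hE' := hE.of_frame hF (by intros; omega) (by simp)
    simp only [eval_sub, eval_mul, eval_x, hE'.card] at hc
    obtain ⟨v, w, hv, hw, he⟩ := hn.exists_pair (show τ.num 14 < _ by omega)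
    have hst : ∀ u, τ.num (16 + 3 * idx u) = σ.st idx u := fun u => hF.num _ (by omega)
    have hadj : τ.num (18 + 3 * τ.num 14) = σ.adj idx v w := by
      rw [he]; exact hF.num _ (by omega)
    have hvis : ∀ u, τ.num (17 + 3 * idx u) = τ.vis idx u := fun u => rfl
    simp only [runs_ite, eval_mul, eval_sub, eval_lit, eval_x, eval_visExp, eval_stExp, NExp.eval,
      eval_add, eval_div, hE'.card, hv, hw, hst, hadj, hvis, runs_seq, runs_assign, runs_skip]
    constructor
    · intro hc2
      -- The product acts as a conjunction: known edge, marked head, unmarked tail, undecided tail.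
      simp only [mul_ne_zero_iff] at hc2
      obtain ⟨⟨⟨hadj1, hwv⟩, hvv⟩, hstv⟩ := hc2
      have hwA : w ∈ A := hp (· ∈ A) (fun a ha _ _ _ _ => ha) hA w hwv
      have hvA : v ∈ A := hK.mem (by omega)
      have hvis' : ∀ u, ((τ.setNum (17 + 3 * idx v) 1).setNum 14 0).vis idx u =
          if u = v then 1 else τ.vis idx u := by
        intro u
        simp only [State.vis, State.setNum, Function.update_apply]
        rw [if_neg (by omega)]
        by_cases huv : u = v
        · rw [huv, if_pos rfl, if_pos rfl]
        · rw [if_neg (fun h => huv (hn.inj (by omega))), if_neg huv]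
      refine ⟨⟨?_, hops, ?_, ?_, ?_⟩, ?_⟩
      · exact hF.extend
      · intro u hu
        rw [hvis']
        split_ifs
        · simp
        · exact hmono u hu
      · intro p hpre hp0 u
        rw [hvis']
        split_ifs with huv
        · intro _
          rw [huv]
          exact hpre v hvA w hwA (hK.sound v w hadj1) (hp p hpre hp0 w hwv)
        · exact hp p hpre hp0 u
      · intro u z hlt
        simp [State.setNum] at hlt
      · have hsub : (Finset.univ.filter fun u =>
            ((τ.setNum (17 + 3 * idx v) 1).setNum 14 0).vis idx u = 0) ⊂
            Finset.univ.filter fun u => τ.vis idx u = 0 := by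
          refine ⟨fun u hu => ?_, fun hsub => ?_⟩
          · simp only [Finset.mem_filter, Finset.mem_univ, true_and, hvis'] at hu ⊢
            split_ifs at hu
            exact hu
          · have := @hsub v (by simp; omega)
            rw [Finset.mem_filter, hvis'] at this
            simp at this
        have hlt := Finset.card_lt_card hsub
        have := Nat.mul_le_mul_right (Fintype.card V * Fintype.card V + 1) hlt
        rw [Nat.succ_mul] at this
        omega
    · intro hc2
      have hvis' : ∀ u, (τ.setNum 14 (τ.num 14 + 1)).vis idx u = τ.vis idx u := by
        intro u
        simp only [State.vis, State.setNum]
        rw [Function.update_of_ne (by omega)]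
      refine ⟨⟨hF.extend, hops, ?_, ?_, ?_⟩, ?_⟩
      · intro u
        rw [hvis']
        exact hmono u
      · intro p hpre hp0 u
        rw [hvis']
        exact hp p hpre hp0 u
      · intro u z hlt huA huz
        rw [hvis', hvis']
        simp only [State.setNum, Function.update_self] at hlt
        rcases Nat.lt_succ_iff_lt_or_eq.1 hlt with hlt | heq
        · exact hdone u z hlt huA huz
        · rw [he, hn.pair_inj] at heq
          obtain ⟨rfl, rfl⟩ := heq
          intro hz hu
          have := hK.lt_two huA
          simp [huz, hz, hu] at hc2
          omega
      · simp only [hvis']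
        simp only [State.setNum, Function.update_self]
        omega
  · rintro τ ⟨hF, hops, hmono, hp, hdone⟩ hc
    have hE' := hE.of_frame hF (by intros; omega) (by simp)
    simp only [eval_sub, eval_mul, eval_x, hE'.card] at hc
    refine ⟨hF, hops, hmono, hp, fun v hv w hw hvw => ?_⟩
    have := hn.pair_lt v w
    exact hdone v w (by omega) (hK.mem (by omega)) (hK.complete v hv w hw hvw)
  · have hvis' : ∀ u, (σ.setNum 14 0).vis idx u = σ.vis idx u := by
      intro u
      simp only [State.vis, State.setNum]
      rw [Function.update_of_ne (by omega)]
    simp only [eval_lit]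
    refine ⟨(Frame.refl _ _ σ).extend, rfl, fun v => ?_, fun p _ hp v => ?_, ?_⟩
    · exact (hvis' v).symm ▸ id
    · exact (hvis' v).symm ▸ hp v
    · intro u w hlt
      simp [State.setNum] at hlt

/-- Looks for a vertex of a bottom component all of whose successors are known; puts its number plus
one into register `6`, or `0` if there is none. -/
def searchKnown : Stmt := block [
  .assign (lit 15) (lit 0),
  .loop (x 1 - x 15) (block [
    .assign (visExp (x 15)) (lit 1 - .reg (stExp (x 15))),
    .assign (lit 15) (x 15 + lit 1)]),
  .assign (lit 6) (lit 0),
  .assign (lit 15) (lit 0),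
  .loop (x 1 - x 15) (block [
    saturate,
    .ite ((lit 1 - .reg (visExp (x 15))) * (lit 2 - .reg (stExp (x 15))))
      (block [
        .assign (lit 6) (x 15 + lit 1),
        .assign (visExp (x 15)) (lit 1)])
      .skip,
    .assign (lit 15) (x 15 + lit 1)])]

/-- The vertices with unknown successors are marked at first, and marks spread backwards. Every
vertex still unmarked when its turn comes becomes the new candidate and is marked. As in the
symbolic search, the last candidate lies in a bottom component. Without any candidate, all marks
stem from the initial ones, so every undecided vertex reaches one with unknown successors. -/
theorem searchKnown_spec {P : MDP V} {L h : ℕ} {idx : V → ℕ} (hn : Numbering L idx)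
    {σ : State V} (hE : Env P L h idx σ) {A : Finset V} (hK : Known P idx A σ) :
    Runs choice searchKnown σ fun τ =>
      Frame (fun a => a = 6 ∨ a = 14 ∨ a = 15 ∨ (17 ≤ a ∧ a % 3 = 2)) (fun _ => False) σ τ ∧
      τ.ops = σ.ops ∧
      ((τ.num 6 = 0 ∧ ∀ v ∈ A, ∃ u ∈ A, σ.st idx u = 0 ∧ P.Reach A v u) ∨
        ∃ r, τ.num 6 = idx r + 1 ∧ P.IsRoot A r) := by
  simp only [searchKnown, block, runs_seq, runs_assign, runs_skip]
  refine runs_loop (fun τ =>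
    Frame (fun a => a = 6 ∨ a = 14 ∨ a = 15 ∨ (17 ≤ a ∧ a % 3 = 2)) (fun _ => False) σ τ ∧
    τ.ops = σ.ops ∧ τ.num 15 ≤ Fintype.card V ∧
    ∀ v, idx v < τ.num 15 → τ.vis idx v = 1 - σ.st idx v)
    (fun τ => Fintype.card V - τ.num 15) ?_ ?_ ?_
  · rintro τ ⟨hF, hops, hle, hv⟩ hc
    have hE' := hE.of_frame hF (by intros; omega) (by simp)
    simp only [eval_sub, eval_x, hE'.card] at hc
    obtain ⟨v, hv15⟩ := hn.exists_eq (show τ.num 15 < _ by omega)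
    have hst : τ.num (16 + 3 * idx v) = σ.st idx v := hF.num _ (by omega)
    simp only [runs_seq, runs_assign, runs_skip, eval_lit, eval_x, eval_visExp, eval_stExp, eval_sub, eval_add,
      NExp.eval, State.setNum, ← hv15, hst]
    have h1715 : (15 : ℕ) ≠ 17 + 3 * idx v := by omega
    simp only [Function.update_self, Function.update_of_ne h1715, ← hv15]
    refine ⟨⟨hF.extend, hops, by omega, fun u hu => ?_⟩, by omega⟩
    simp only [State.vis, Function.update_apply]
    rw [if_neg (by omega)]
    by_cases huv : u = v
    · rw [huv, if_pos rfl]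
    · have h1 : idx u ≠ idx v := fun h => huv (hn.inj h)
      rw [if_neg (by omega)]
      exact hv u (by omega)
  · rintro σ₁ ⟨hF₁, hops₁, hle, hv⟩ hc
    have hE₁ := hE.of_frame hF₁ (by intros; omega) (by simp)
    simp only [eval_sub, eval_x, hE₁.card] at hc
    replace hv : ∀ v, σ₁.vis idx v = 1 - σ.st idx v := fun v =>
      hv v (by have := hn.lt v; omega)
    refine runs_loop (fun τ =>
      Frame (fun a => a = 6 ∨ a = 14 ∨ a = 15 ∨ (17 ≤ a ∧ a % 3 = 2)) (fun _ => False) σ τ ∧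
      τ.ops = σ.ops ∧ (∀ v ∈ A, idx v < τ.num 15 → τ.vis idx v ≠ 0) ∧
      (∀ v, τ.vis idx v ≠ 0 → v ∈ A) ∧ (∀ v, σ.st idx v = 0 → τ.vis idx v ≠ 0) ∧
      ((τ.num 6 = 0 ∧ ∀ v, τ.vis idx v ≠ 0 → ∃ u ∈ A, σ.st idx u = 0 ∧ P.Reach A v u) ∨
        ∃ r ∈ A, τ.num 6 = idx r + 1 ∧ ∃ p : V → Prop,
          (∀ a ∈ A, ∀ b ∈ A, (a, b) ∈ P.edges → p b → p a) ∧ ¬ p r ∧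
          ∀ v, τ.vis idx v ≠ 0 → p v ∨ P.Reach A v r))
      (fun τ => Fintype.card V - τ.num 15) ?_ ?_ ?_
    · rintro σ₂ ⟨hF₂, hops₂, hdone₂, hA₂, hst₂, hroot₂⟩ hc
      have hE₂ := hE.of_frame hF₂ (by intros; omega) (by simp)
      simp only [eval_sub, eval_x, hE₂.card] at hc
      have hst : ∀ v, σ₂.st idx v = σ.st idx v := fun v => hF₂.num _ (by omega)
      have hadj : ∀ v w, σ₂.adj idx v w = σ.adj idx v w := fun v w => hF₂.num _ (by omega)
      have hK₂ : Known P idx A σ₂ :=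
        ⟨by simpa only [hst] using hK.le_two, by simpa only [hst] using hK.eq_two,
          by simpa only [hadj] using hK.sound, by simpa only [hst, hadj] using hK.complete⟩
      rw [runs_seq]
      refine Runs.mono (saturate_spec hn hE₂ hK₂ hA₂) ?_
      rintro τ ⟨hF₃, hops₃, hmono, hp, hcl⟩
      have hF := hF₂.trans (hF₃.mono (by intros; omega) (by simp))
      have hE' := hE.of_frame hF (by intros; omega) (by simp)
      have h15 : τ.num 15 = σ₂.num 15 := hF₃.num _ (by omega)
      have h6 : τ.num 6 = σ₂.num 6 := hF₃.num _ (by omega)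
      have hA' : ∀ v, τ.vis idx v ≠ 0 → v ∈ A := hp (· ∈ A) (fun a ha _ _ _ _ => ha) hA₂
      have hst' : ∀ v, σ.st idx v = 0 → τ.vis idx v ≠ 0 := fun v hv => hmono v (hst₂ v hv)
      -- Known edges suffice for closure under all edges within `A`: a vertex with missing edges is
      -- marked from the start.
      have hpre : ∀ a ∈ A, ∀ b ∈ A, (a, b) ∈ P.edges → τ.vis idx b ≠ 0 → τ.vis idx a ≠ 0 := by
        intro a ha b hb hab
        rcases Nat.lt_or_ge 0 (σ.st idx a) with h0 | h0
        · have := hK.lt_two ha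
          exact hcl a (by rw [hst]; omega) b hb hab
        · exact fun _ => hst' a (by omega)
      have hroot : (τ.num 6 = 0 ∧ ∀ v, τ.vis idx v ≠ 0 →
            ∃ u ∈ A, σ.st idx u = 0 ∧ P.Reach A v u) ∨
          ∃ r ∈ A, τ.num 6 = idx r + 1 ∧ ∃ p : V → Prop,
            (∀ a ∈ A, ∀ b ∈ A, (a, b) ∈ P.edges → p b → p a) ∧ ¬ p r ∧
            ∀ v, τ.vis idx v ≠ 0 → p v ∨ P.Reach A v r := by
        rw [h6]
        rcases hroot₂ with ⟨h1, h2⟩ | ⟨r, hrA, h1, p, hp1, hp2, hp3⟩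
        · refine Or.inl ⟨h1, hp _ (fun a ha b hb hab => ?_) h2⟩
          rintro ⟨u, huA, hu0, hbu⟩
          exact ⟨u, huA, hu0, hbu.head ⟨ha, hb, hab⟩⟩
        · refine Or.inr ⟨r, hrA, h1, p, hp1, hp2, hp _ (fun a ha b hb hab => ?_) hp3⟩
          rintro (h | h)
          · exact Or.inl (hp1 a ha b hb hab h)
          · exact Or.inr (h.head ⟨ha, hb, hab⟩)
      obtain ⟨q, hq⟩ := hn.exists_eq (show σ₂.num 15 < _ by omega)
      have hq15 : τ.num 15 = idx q := h15.trans hq.symm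
      have hm : Fintype.card V - (idx q + 1) < Fintype.card V - σ₂.num 15 := by
        clear hroot hroot₂
        omega
      have hstq : τ.num (16 + 3 * idx q) = σ.st idx q := hF.num _ (by omega)
      have hvisq : τ.num (17 + 3 * idx q) = τ.vis idx q := rfl
      simp only [runs_seq, runs_ite, runs_assign, runs_skip, eval_lit, eval_x, eval_visExp,
        eval_stExp, eval_sub, eval_mul, eval_add, NExp.eval, State.setNum, hq15, hstq, hvisq,
        Function.update_self, Function.update_of_ne, ne_eq, Nat.reduceEqDiff, not_false_eq_true]
      have h1715 : (15 : ℕ) ≠ 17 + 3 * idx q := by omega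
      have h1706 : (6 : ℕ) ≠ 17 + 3 * idx q := by omega
      have h1506 : (6 : ℕ) ≠ 15 := by omega
      have h1517 : ∀ u, 17 + 3 * idx u ≠ 15 := by intros; omega
      have h0617 : ∀ u, 17 + 3 * idx u ≠ 6 := by intros; omega
      have h0615 : (15 : ℕ) ≠ 6 := by omega
      simp only [Function.update_of_ne h1715, Function.update_of_ne h0615, hq15]
      constructor
      · intro hc2
        have hvq : τ.vis idx q = 0 ∧ σ.st idx q < 2 := by
          simp only [mul_eq_zero, not_or] at hc2
          omega
        have hqA : q ∈ A := hK.mem hvq.2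
        have hvis' : ∀ u, Function.update (Function.update (Function.update τ.num 6 (idx q + 1))
            (17 + 3 * idx q) 1) 15 (idx q + 1) (17 + 3 * idx u) =
            if u = q then 1 else τ.vis idx u := by
          intro u
          rw [Function.update_of_ne (h1517 u)]
          by_cases huq : u = q
          · rw [huq, Function.update_self, if_pos rfl]
          · rw [Function.update_of_ne fun h => huq (hn.inj (by omega)),
              Function.update_of_ne (h0617 u), if_neg huq]
            rfl
        refine ⟨⟨hF.extend, hops₃.trans hops₂, ?_, ?_, ?_, Or.inr ⟨q, hqA, ?_,
          fun v => τ.vis idx v ≠ 0, hpre, by simp [hvq.1], ?_⟩⟩, hm⟩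
        · intro v hvA hlt
          simp only [State.vis, hvis']
          split_ifs with h
          · simp
          · have h1 : idx v ≠ idx q := fun h' => h (hn.inj h')
            exact hmono v (hdone₂ v hvA (by omega))
        · intro v
          simp only [State.vis, hvis']
          split_ifs with h
          · exact fun _ => h ▸ hqA
          · exact hA' v
        · intro v hv0
          simp only [State.vis, hvis']
          split_ifs with h
          · simp
          · exact hst' v hv0
        · rw [Function.update_of_ne h1706, Function.update_self]
        · intro v
          simp only [State.vis, hvis']
          split_ifs with h
          · exact fun _ => Or.inr (h ▸ .refl)
          · exact fun hv => Or.inl hv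
      · intro hc2
        have hvis' : ∀ u, Function.update τ.num 15 (idx q + 1) (17 + 3 * idx u) =
            τ.vis idx u := fun u => Function.update_of_ne (h1517 u) _ _
        refine ⟨⟨hF.extend, hops₃.trans hops₂, ?_, ?_, ?_, ?_⟩, hm⟩
        · intro v hvA hlt
          simp only [State.vis, hvis']
          by_cases h : v = q
          · subst h
            have := hK.lt_two hvA
            simp only [mul_eq_zero] at hc2
            have h3 : τ.vis idx v ≠ 0 := by omega
            exact h3
          · have h1 : idx v ≠ idx q := fun h' => h (hn.inj h')
            exact hmono v (hdone₂ v hvA (by omega))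
        · intro v
          simp only [State.vis, hvis']
          exact hA' v
        · intro v hv0
          simp only [State.vis, hvis']
          exact hst' v hv0
        · simp only [State.vis, hvis', Function.update_of_ne h1506]
          exact hroot
    · rintro τ ⟨hF, hops, hdone, hA', hst', hroot⟩ hc
      have hE' := hE.of_frame hF (by intros; omega) (by simp)
      simp only [eval_sub, eval_x, hE'.card] at hc
      -- The marks need not be saturated after the last candidate, since by now they cover `A`.
      have hall : ∀ v ∈ A, τ.vis idx v ≠ 0 := fun v hv =>
        hdone v hv (by have := hn.lt v; omega)
      refine ⟨hF, hops, ?_⟩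
      rcases hroot with ⟨h1, h2⟩ | ⟨r, hrA, h1, p, hp1, hp2, hp3⟩
      · exact Or.inl ⟨h1, fun v hv => h2 v (hall v hv)⟩
      · exact Or.inr ⟨r, h1, MDP.isRoot_of_pre_closed hrA hp1 hp2 fun v hv => hp3 v (hall v hv)⟩
    · have hvis' : ∀ u, Function.update (Function.update σ₁.num 6 0) 15 0 (17 + 3 * idx u) =
          1 - σ.st idx u := by
        intro u
        rw [Function.update_of_ne (by omega), Function.update_of_ne (by omega)]
        exact hv u
      simp only [State.setNum, eval_lit, State.vis, hvis', Function.update_self,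
        Function.update_of_ne, ne_eq, Nat.reduceEqDiff, not_false_eq_true]
      refine ⟨hF₁.extend, hops₁, by simp, fun v hv0 => hK.mem (by omega), by intros; omega, ?_⟩
      refine Or.inl ⟨trivial, fun v hv0 => ⟨v, hK.mem (by omega), by omega, .refl⟩⟩
  · simp only [eval_lit]
    refine ⟨(Frame.refl _ _ σ).extend, rfl, by simp [State.setNum], ?_⟩
    intro v hv
    simp [State.setNum] at hv

end Symbolic

/-! ## Learning the successors of vertices -/

namespace Symbolic

set_option linter.unusedSimpArgs false
set_option linter.flexible false

section Unknown

variable {V : Type*} [Fintype V]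

/-- The number of the vertices that are undecided and whose successors are not known. -/
def State.unknown (σ : State V) (idx : V → ℕ) : ℕ :=
  (Finset.univ.filter fun v => σ.st idx v = 0).card

theorem State.unknown_mk {σ : State V} {idx : V → ℕ} {num : ℕ → ℕ} {vert : ℕ → Finset V}
    {edge : ℕ → Finset (V × V)} {out : List (Finset V)} {ops vertRegs edgeRegs : ℕ}
    (h : ∀ v, num (16 + 3 * idx v) = σ.st idx v) :
    State.unknown ⟨num, vert, edge, out, ops, vertRegs, edgeRegs⟩ idx = σ.unknown idx :=
  congrArg _ (Finset.filter_congr fun v _ => by rw [← h v]; rfl)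

end Unknown

variable {V : Type*} [Fintype V] [DecidableEq V] {choice : ℕ → Finset V → V}

/-- Records that the vertices in register `10` are decided. -/
def markDecided : Stmt := block [
  .sym (.card (lit 9) (lit 10)),
  .loop (x 9) (block [
    .sym (.pick (lit 4) (lit 10)),
    .sym (.vertOp .diff (lit 10) (lit 10) (lit 4)),
    identify,
    .assign (stExp (x 10)) (lit 2),
    .sym (.card (lit 9) (lit 10))])]

/-- Each vertex costs the `L` tests of `identify`, a pick, a difference and a cardinality. -/
theorem markDecided_spec (hch : ∀ t X, X.Nonempty → choice t X ∈ X)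
    {P : MDP V} {L h : ℕ} {idx : V → ℕ} (hn : Numbering L idx) {σ : State V}
    (hE : Env P L h idx σ) {D : Finset V} (hD : σ.vert 10 = D) :
    Runs choice markDecided σ fun τ =>
      Frame (fun a => (9 ≤ a ∧ a ≤ 13) ∨ (16 ≤ a ∧ a % 3 = 1)) (fun a => a = 4 ∨ a = 10) σ τ ∧
      (∀ v, τ.st idx v = if v ∈ D then 2 else σ.st idx v) ∧
      τ.ops = σ.ops + 1 + (L + 3) * D.card := by
  simp only [markDecided, block, runs_seq, runs_skip, runs_sym]
  refine runs_loop (fun τ =>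
    Frame (fun a => (9 ≤ a ∧ a ≤ 13) ∨ (16 ≤ a ∧ a % 3 = 1)) (fun a => a = 4 ∨ a = 10) σ τ ∧
    τ.num 9 = (τ.vert 10).card ∧ τ.vert 10 ⊆ D ∧
    (∀ v, τ.st idx v = if v ∈ D ∧ v ∉ τ.vert 10 then 2 else σ.st idx v) ∧
    τ.ops + (L + 3) * (τ.vert 10).card = σ.ops + 1 + (L + 3) * D.card)
    (fun τ => (τ.vert 10).card) ?_ ?_ ?_
  · rintro τ ⟨hF, h9, hsub, hst, hops⟩ hc
    simp only [eval_x, h9] at hc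
    have hne : (τ.vert 10).Nonempty := Finset.card_ne_zero.1 hc
    set T := τ.vert 10 with hT
    set r := choice τ.ops T
    have hrT : r ∈ T := hch _ _ hne
    have hcard : (T \ {r}).card + 1 = T.card := by
      rw [Finset.sdiff_singleton_eq_erase]; exact Finset.card_erase_add_one hrT
    simp only [runs_seq, runs_sym, runs_assign, runs_skip, Instr.step, Instr.effect, State.setNum,
      State.setVert, SetOp.eval, eval_lit, eval_x, Function.update_self, Function.update_of_ne,
      ne_eq, Nat.reduceEqDiff, not_false_eq_true, ← hT, if_pos hne]
    refine Runs.mono (identify_spec hn (hE.of_frame hF.extend (by intros; omega)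
      (by intros; omega)) (v := r) rfl) ?_
    rintro τ' ⟨hF', h10, hops'⟩
    have hF'' := Frame.trans (Frame.extend hF) (hF'.mono (N' := fun a => (9 ≤ a ∧ a ≤ 13) ∨
      (16 ≤ a ∧ a % 3 = 1)) (W' := fun a => a = 4 ∨ a = 10) (by intros; omega) (by simp))
    have hv10 : τ'.vert 10 = T \ {r} := by
      rw [hF'.vert 10 (by simp)]
      simp [r]
    have hst' : ∀ u, τ'.num (16 + 3 * idx u) = τ.st idx u := fun u => hF'.num _ (by omega)
    simp only at hops'
    simp only [runs_seq, runs_sym, runs_assign, runs_skip, Instr.step, Instr.effect, State.setNum,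
      State.setVert, SetOp.eval, eval_lit, eval_x, Function.update_self, Function.update_of_ne,
      ne_eq, Nat.reduceEqDiff, not_false_eq_true, eval_stExp, h10, hv10]
    refine ⟨⟨hF''.extend, trivial, Finset.sdiff_subset.trans hsub, fun v => ?_, ?_⟩, by omega⟩
    · simp only [State.st]
      rw [Function.update_of_ne (by omega)]
      by_cases hvr : v = r
      · rw [hvr, Function.update_self, if_pos ⟨hsub hrT, by simp⟩]
      · rw [Function.update_of_ne (fun h => hvr (hn.inj (by omega))), hst' v, hst v]
        simp [hvr, State.st]
    · have : (L + 3) * T.card = (L + 3) * (T \ {r}).card + (L + 3) := by rw [← hcard, Nat.mul_succ]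
      omega
  · rintro τ ⟨hF, h9, hsub, hst, hops⟩ hc
    simp only [eval_x, h9, Finset.card_eq_zero] at hc
    refine ⟨hF, fun v => ?_, by simpa [hc] using hops⟩
    rw [hst v]
    simp [hc]
  · simp only [runs_seq, runs_sym, runs_assign, runs_skip, Instr.step, Instr.effect, State.setNum,
      State.setVert, SetOp.eval, eval_lit, eval_x, Function.update_self, Function.update_of_ne,
      ne_eq, Nat.reduceEqDiff, not_false_eq_true, hD]
    refine ⟨(Frame.refl _ _ σ).extend, trivial, subset_rfl, fun v => ?_, trivial⟩
    rw [if_neg (by simp)]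
    simp only [State.st]
    rw [Function.update_of_ne (by omega)]

/-- A row that is complete for `A` is complete for any smaller set, and entries that point to
decided vertices are still true edges. The matrix never has to be cleaned. -/
theorem Known.restrict {P : MDP V} {idx : V → ℕ} {A A' : Finset V} {σ τ : State V}
    (hK : Known P idx A σ) (hA : A' ⊆ A)
    (hst : ∀ v, τ.st idx v = if v ∈ A \ A' then 2 else σ.st idx v)
    (hadj : ∀ v w, τ.adj idx v w = σ.adj idx v w) : Known P idx A' τ where
  le_two v := by
    rw [hst]
    split_ifs
    · exact le_rfl
    · exact hK.le_two v
  eq_two v := by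
    rw [hst]
    split_ifs with h
    · simp only [true_iff]
      exact (Finset.mem_sdiff.1 h).2
    · rw [hK.eq_two]
      have := @hA v
      simp only [Finset.mem_sdiff] at h
      tauto
  sound v w := by rw [hadj]; exact hK.sound v w
  complete v hv w hw hvw := by
    rw [hst] at hv
    rw [hadj]
    split_ifs at hv
    · omega
    · exact hK.complete v hv w (hA hw) hvw

/-- Records edges from the vertex whose number is in register `7` to all the vertices in
register `6`. -/
def learnRow : Stmt :=
  .loop (x 9) (block [
    .sym (.pick (lit 4) (lit 6)),
    .sym (.vertOp .diff (lit 6) (lit 6) (lit 4)),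
    identify,
    .assign (adjExp (x 7) (x 10)) (lit 1),
    .sym (.card (lit 9) (lit 6))])

theorem learnRow_spec (hch : ∀ t X, X.Nonempty → choice t X ∈ X)
    {P : MDP V} {L h : ℕ} {idx : V → ℕ} (hn : Numbering L idx) {σ : State V}
    (hE : Env P L h idx σ) {v : V} {N : Finset V} (h7 : σ.num 7 = idx v) (h6 : σ.vert 6 = N)
    (h9 : σ.num 9 = N.card) :
    Runs choice learnRow σ fun τ =>
      Frame (fun a => (9 ≤ a ∧ a ≤ 13) ∨ (18 ≤ a ∧ a % 3 = 0)) (fun a => a = 4 ∨ a = 6) σ τ ∧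
      (∀ u w, τ.adj idx u w ≠ 0 ↔ σ.adj idx u w ≠ 0 ∨ (u = v ∧ w ∈ N)) ∧
      τ.ops = σ.ops + (L + 3) * N.card := by
  simp only [learnRow, block]
  refine runs_loop (fun τ =>
    Frame (fun a => (9 ≤ a ∧ a ≤ 13) ∨ (18 ≤ a ∧ a % 3 = 0)) (fun a => a = 4 ∨ a = 6) σ τ ∧
    τ.num 9 = (τ.vert 6).card ∧ τ.vert 6 ⊆ N ∧
    (∀ u w, τ.adj idx u w ≠ 0 ↔ σ.adj idx u w ≠ 0 ∨ (u = v ∧ w ∈ N ∧ w ∉ τ.vert 6)) ∧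
    τ.ops + (L + 3) * (τ.vert 6).card = σ.ops + (L + 3) * N.card)
    (fun τ => (τ.vert 6).card) ?_ ?_ ?_
  · rintro τ ⟨hF, h9, hsub, hadj, hops⟩ hc
    simp only [eval_x, h9] at hc
    have hne : (τ.vert 6).Nonempty := Finset.card_ne_zero.1 hc
    set T := τ.vert 6 with hT
    set r := choice τ.ops T
    have hrT : r ∈ T := hch _ _ hne
    have hcard : (T \ {r}).card + 1 = T.card := by
      rw [Finset.sdiff_singleton_eq_erase]; exact Finset.card_erase_add_one hrT
    simp only [runs_seq, runs_sym, runs_assign, runs_skip, Instr.step, Instr.effect, State.setNum,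
      State.setVert, SetOp.eval, eval_lit, eval_x, Function.update_self, Function.update_of_ne,
      ne_eq, Nat.reduceEqDiff, not_false_eq_true, ← hT, if_pos hne]
    refine Runs.mono (identify_spec hn (hE.of_frame hF.extend (by intros; omega)
      (by intros; omega)) (v := r) rfl) ?_
    rintro τ' ⟨hF', h10, hops'⟩
    have hF'' := Frame.trans (Frame.extend hF) (hF'.mono (N' := fun a => (9 ≤ a ∧ a ≤ 13) ∨
      (18 ≤ a ∧ a % 3 = 0)) (W' := fun a => a = 4 ∨ a = 6) (by intros; omega) (by simp))
    have hE' := hE.of_frame hF'' (by intros; omega) (by intros; omega)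
    have hv6 : τ'.vert 6 = T \ {r} := by
      rw [hF'.vert 6 (by simp)]
      simp [r]
    have h7' : τ'.num 7 = idx v := by rw [hF''.num 7 (by omega), h7]
    have hadj' : ∀ u w, τ'.num (18 + 3 * (idx u * Fintype.card V + idx w)) = τ.adj idx u w :=
      fun u w => hF'.num _ (by omega)
    simp only at hops'
    simp only [runs_seq, runs_sym, runs_assign, runs_skip, Instr.step, Instr.effect, State.setNum,
      State.setVert, SetOp.eval, eval_lit, eval_x, Function.update_self, Function.update_of_ne,
      ne_eq, Nat.reduceEqDiff, not_false_eq_true, eval_adjExp, h10, hv6, h7', hE'.card]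
    refine ⟨⟨hF''.extend, trivial, Finset.sdiff_subset.trans hsub, fun u w => ?_, ?_⟩, by omega⟩
    · simp only [State.adj]
      rw [Function.update_of_ne (by omega)]
      by_cases hvr : u = v ∧ w = r
      · rw [hvr.1, hvr.2, Function.update_self]
        simp [hsub hrT]
      · rw [Function.update_of_ne (fun h => hvr (hn.pair_inj.1 (by omega))), hadj' u w, ← ne_eq,
          hadj u w]
        simp only [State.adj, Finset.mem_sdiff, Finset.mem_singleton]
        tauto
    · have : (L + 3) * T.card = (L + 3) * (T \ {r}).card + (L + 3) := by rw [← hcard, Nat.mul_succ]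
      omega
  · rintro τ ⟨hF, h9, hsub, hadj, hops⟩ hc
    simp only [eval_x, h9, Finset.card_eq_zero] at hc
    refine ⟨hF, fun u w => ?_, by simpa [hc] using hops⟩
    rw [hadj u w]
    simp [hc]
  · refine ⟨Frame.refl _ _ σ, by rw [h6, h9], by rw [h6], fun u w => ?_, by rw [h6]⟩
    rw [h6]
    tauto

/-- Learns the successors of all the undecided vertices with few undecided successors. -/
def refresh : Stmt := block [
  .sym (.vertOp .union (lit 5) (lit 3) (lit 3)),
  .sym (.card (lit 8) (lit 5)),
  .loop (x 8) (block [
    .sym (.pick (lit 4) (lit 5)),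
    .sym (.vertOp .diff (lit 5) (lit 5) (lit 4)),
    identify,
    .ite (.reg (stExp (x 10))) .skip (block [
      .sym (.post (lit 6) (lit 0) (lit 4)),
      .sym (.vertOp .inter (lit 6) (lit 6) (lit 3)),
      .sym (.card (lit 9) (lit 6)),
      .ite (x 9 - lit 2 * x 3) .skip (block [
        .assign (lit 7) (x 10),
        .assign (stExp (x 7)) (lit 1),
        learnRow])]),
    .sym (.card (lit 8) (lit 5))])]

/-- A visited vertex costs at most `L + 6` operations apart from its row. A row has at most `2 * h`
entries of `L + 3` operations each, and is paid for by the drop of `unknown`, so over the whole run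
every vertex pays for one row only. -/
theorem refresh_spec (hch : ∀ t X, X.Nonempty → choice t X ∈ X)
    {P : MDP V} {L h : ℕ} {idx : V → ℕ} (hn : Numbering L idx) {σ : State V}
    (hE : Env P L h idx σ) {A : Finset V} (hA : σ.vert 3 = A) (hK : Known P idx A σ) :
    Runs choice refresh σ fun τ =>
      Frame (fun a => (7 ≤ a ∧ a ≤ 13) ∨ (16 ≤ a ∧ a % 3 ≠ 2))
        (fun a => a = 4 ∨ a = 5 ∨ a = 6) σ τ ∧ Known P idx A τ ∧
      (∀ v ∈ A, τ.st idx v = 0 → 2 * h < (post P.edges {v} ∩ A).card) ∧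
      τ.ops + (L + 3) * (2 * h) * τ.unknown idx ≤
        σ.ops + 2 + (L + 6) * A.card + (L + 3) * (2 * h) * σ.unknown idx := by
  simp only [refresh, block, runs_seq, runs_skip, runs_sym]
  refine runs_loop (fun τ =>
    Frame (fun a => (7 ≤ a ∧ a ≤ 13) ∨ (16 ≤ a ∧ a % 3 ≠ 2))
      (fun a => a = 4 ∨ a = 5 ∨ a = 6) σ τ ∧ τ.num 8 = (τ.vert 5).card ∧ τ.vert 5 ⊆ A ∧
    Known P idx A τ ∧
    (∀ v ∈ A, v ∉ τ.vert 5 → τ.st idx v = 0 → 2 * h < (post P.edges {v} ∩ A).card) ∧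
    τ.ops + (L + 3) * (2 * h) * τ.unknown idx + (L + 6) * (τ.vert 5).card ≤
        σ.ops + 2 + (L + 6) * A.card + (L + 3) * (2 * h) * σ.unknown idx)
    (fun τ => (τ.vert 5).card) ?_ ?_ ?_
  · rintro τ ⟨hF, h8, hsub, hK', hdeg, hops⟩ hc
    simp only [eval_x, h8] at hc
    have hne : (τ.vert 5).Nonempty := Finset.card_ne_zero.1 hc
    set T := τ.vert 5 with hT
    set r := choice τ.ops T
    have hrT : r ∈ T := hch _ _ hne
    have hcard : (T \ {r}).card + 1 = T.card := by
      rw [Finset.sdiff_singleton_eq_erase]; exact Finset.card_erase_add_one hrT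
    simp only [runs_seq, runs_sym, runs_assign, runs_skip, Instr.step, Instr.effect, State.setNum,
      State.setVert, SetOp.eval, eval_lit, eval_x, Function.update_self, Function.update_of_ne,
      ne_eq, Nat.reduceEqDiff, not_false_eq_true, ← hT, if_pos hne]
    refine Runs.mono (identify_spec hn (hE.of_frame hF.extend (by intros; omega)
      (by intros; omega)) (v := r) rfl) ?_
    rintro τ₁ ⟨hF', h10, hops₁⟩
    have hF₁ := Frame.trans (Frame.extend hF) (hF'.mono
      (N' := fun a => (7 ≤ a ∧ a ≤ 13) ∨ (16 ≤ a ∧ a % 3 ≠ 2))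
      (W' := fun a => a = 4 ∨ a = 5 ∨ a = 6) (by intros; omega) (by simp))
    have hE₁ := hE.of_frame hF₁ (by intros; omega) (by intros; omega)
    have hv5 : τ₁.vert 5 = T \ {r} := by
      rw [hF'.vert 5 (by simp)]
      simp [r]
    have hv4 : τ₁.vert 4 = {r} := by
      rw [hF'.vert 4 (by simp)]
      simp [r]
    have hv3 : τ₁.vert 3 = A := by rw [hF₁.vert 3 (by omega), hA]
    have hst₁ : ∀ u, τ₁.num (16 + 3 * idx u) = τ.st idx u := fun u => hF'.num _ (by omega)
    have hadj₁ : ∀ u w, τ₁.num (18 + 3 * (idx u * Fintype.card V + idx w)) = τ.adj idx u w :=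
      fun u w => hF'.num _ (by omega)
    have hsub' : T \ {r} ⊆ A := Finset.sdiff_subset.trans hsub
    have hmem : ∀ v, v ∉ T \ {r} → v = r ∨ v ∉ T := by
      intro v hv
      simp only [Finset.mem_sdiff, Finset.mem_singleton] at hv
      tauto
    simp only at hops₁
    simp only [runs_seq, runs_sym, runs_assign, runs_skip, Instr.step, Instr.effect, State.setNum,
      State.setVert, SetOp.eval, eval_lit, eval_x, Function.update_self, Function.update_of_ne,
      ne_eq, Nat.reduceEqDiff, not_false_eq_true, runs_ite, eval_stExp, eval_sub, eval_mul,
      NExp.eval, h10, hst₁]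
    have hcard' : (L + 6) * T.card = (L + 6) * (T \ {r}).card + (L + 6) := by
      rw [← hcard, Nat.mul_succ]
    constructor
    · intro hst
      have hst₂ : ∀ u, (Function.update τ₁.num 8 (τ₁.vert 5).card) (16 + 3 * idx u) =
          τ.st idx u := fun u => by rw [Function.update_of_ne (by omega), hst₁]
      have hadj₂ : ∀ u w, (Function.update τ₁.num 8 (τ₁.vert 5).card)
          (18 + 3 * (idx u * Fintype.card V + idx w)) = τ.adj idx u w :=
        fun u w => by rw [Function.update_of_ne (by omega), hadj₁]
      refine ⟨⟨hF₁.extend, trivial, hv5 ▸ hsub', ⟨?_, ?_, ?_, ?_⟩, ?_, ?_⟩, ?_⟩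
      · simpa only [State.st, hst₂] using hK'.le_two
      · simpa only [State.st, hst₂] using hK'.eq_two
      · simpa only [State.adj, hadj₂] using hK'.sound
      · simpa only [State.st, State.adj, hst₂, hadj₂] using hK'.complete
      · intro v hvA hv
        simp only [State.st, hst₂]
        rcases hmem v (hv5 ▸ hv) with rfl | hv
        · exact fun h => absurd h hst
        · exact hdeg v hvA hv
      · rw [hv5]
        have : State.unknown ⟨Function.update τ₁.num 8 (T \ {r}).card, τ₁.vert, τ₁.edge, τ₁.out,
            τ₁.ops + 1, τ₁.vertRegs, τ₁.edgeRegs⟩ idx = τ.unknown idx := by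
          rw [hv5] at hst₂
          exact State.unknown_mk hst₂
        rw [this]
        omega
      · rw [hv5]; omega
    · intro hst
      have h3 : τ₁.num 3 = h := hE₁.thr
      simp only [runs_seq, runs_sym, runs_assign, runs_skip, Instr.step, Instr.effect,
        State.setNum, State.setVert, SetOp.eval, eval_lit, eval_x, Function.update_self,
        Function.update_of_ne, ne_eq, Nat.reduceEqDiff, not_false_eq_true, hv4, hv3, hE₁.edge, h3,
        h10]
      generalize hNdef : post P.edges {r} ∩ A = N
      have hN : ∀ w, w ∈ N ↔ (r, w) ∈ P.edges ∧ w ∈ A := by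
        intro w; rw [← hNdef]; simp [post]
      constructor
      · intro hbig
        generalize hm : Function.update (Function.update τ₁.num 9 N.card) 8 _ = m
        have hst₂ : ∀ u, m (16 + 3 * idx u) =
            τ.st idx u := fun u => by
          rw [← hm, Function.update_of_ne (by omega), Function.update_of_ne (by omega), hst₁]
        have hadj₂ : ∀ u w, m (18 + 3 * (idx u * Fintype.card V + idx w)) = τ.adj idx u w :=
          fun u w => by
            rw [← hm, Function.update_of_ne (by omega), Function.update_of_ne (by omega), hadj₁]
        have hm8 : m 8 = (T \ {r}).card := by rw [← hm, Function.update_self, hv5]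
        refine ⟨⟨hF₁.extend ?_, ?_, hv5 ▸ hsub', ⟨?_, ?_, ?_, ?_⟩, ?_, ?_⟩, ?_⟩
        · intro a ha
          rw [← hm]
          simp only [Function.update_apply]
          split_ifs <;> omega
        · trivial
        · simpa only [State.st, hst₂] using hK'.le_two
        · simpa only [State.st, hst₂] using hK'.eq_two
        · simpa only [State.adj, hadj₂] using hK'.sound
        · simpa only [State.st, State.adj, hst₂, hadj₂] using hK'.complete
        · intro v hvA hv
          simp only [State.st, hst₂]
          rcases hmem v (hv5 ▸ hv) with rfl | hv
          · intro _
            rw [hNdef]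
            omega
          · exact hdeg v hvA hv
        · rw [State.unknown_mk (σ := τ) hst₂]
          simp only [hv5]
          omega
        · rw [hv5]; omega
      · intro hsmall
        refine Runs.mono (learnRow_spec hch hn (hE.of_frame hF₁.extend (by intros; omega)
          (by intros; omega)) (v := r) (N := N) ?_ ?_ ?_) ?_
        · simp only
          rw [Function.update_of_ne (by omega)]
          simp
        · simp
        · simp only
          rw [Function.update_of_ne (by omega)]
          simp
        rintro τ₂ ⟨hF₂', hadj₂, hops₂⟩
        have hF₂ := Frame.trans (Frame.extend hF₁) (hF₂'.mono
          (N' := fun a => (7 ≤ a ∧ a ≤ 13) ∨ (16 ≤ a ∧ a % 3 ≠ 2))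
          (W' := fun a => a = 4 ∨ a = 5 ∨ a = 6) (by intros; omega) (by intros; omega))
        have hv5' : τ₂.vert 5 = T \ {r} := by
          rw [hF₂'.vert 5 (by omega)]
          simpa using hv5
        have hst₂ : ∀ u, τ₂.st idx u = if u = r then 1 else τ.st idx u := by
          intro u
          simp only [State.st]
          rw [hF₂'.num _ (by omega)]
          simp only
          by_cases hur : u = r
          · rw [hur, Function.update_self, if_pos rfl]
          · rw [if_neg hur, Function.update_of_ne (fun h => hur (hn.inj (by omega))),
              Function.update_of_ne (by omega), Function.update_of_ne (by omega), hst₁]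
            rfl
        replace hadj₂ : ∀ u w, τ₂.adj idx u w ≠ 0 ↔ τ.adj idx u w ≠ 0 ∨ (u = r ∧ w ∈ N) := by
          intro u w
          rw [hadj₂ u w]
          simp only [State.adj]
          rw [Function.update_of_ne (by omega), Function.update_of_ne (by omega),
            Function.update_of_ne (by omega), hadj₁]
          rfl
        simp only at hops₂
        have hst₃ : ∀ u, Function.update τ₂.num 8 (T \ {r}).card (16 + 3 * idx u) =
            if u = r then 1 else τ.st idx u := fun u => by
          rw [Function.update_of_ne (by omega), ← hst₂]
          rfl
        have hadj₃ : ∀ u w, Function.update τ₂.num 8 (T \ {r}).card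
            (18 + 3 * (idx u * Fintype.card V + idx w)) ≠ 0 ↔
              τ.adj idx u w ≠ 0 ∨ (u = r ∧ w ∈ N) := fun u w => by
          rw [Function.update_of_ne (by omega), ← hadj₂]
          rfl
        have hrA := hsub hrT
        simp only [runs_seq, runs_sym, runs_assign, runs_skip, Instr.step, Instr.effect,
          State.setNum, State.setVert, SetOp.eval, eval_lit, eval_x, Function.update_self,
          Function.update_of_ne, ne_eq, Nat.reduceEqDiff, not_false_eq_true, hv5']
        refine ⟨⟨hF₂.extend, trivial, hsub', ⟨?_, ?_, ?_, ?_⟩, ?_, ?_⟩, by omega⟩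
        · intro u
          simp only [State.st, hst₃]
          split_ifs
          · omega
          · exact hK'.le_two u
        · intro u
          simp only [State.st, hst₃]
          split_ifs with hur
          · simp [hur, hrA]
          · exact hK'.eq_two u
        · intro u w huw
          rcases (hadj₃ u w).1 huw with h1 | ⟨rfl, h1⟩
          · exact hK'.sound u w h1
          · exact ((hN w).1 h1).1
        · intro u hu w hw huw
          simp only [State.st, hst₃] at hu
          refine (hadj₃ u w).2 ?_
          split_ifs at hu with hur
          · exact Or.inr ⟨hur, (hN w).2 ⟨hur ▸ huw, hw⟩⟩
          · exact Or.inl (hK'.complete u hu w hw huw)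
        · intro v hvA hv
          simp only [State.st, hst₃]
          split_ifs with hvr
          · simp
          · exact hdeg v hvA ((hmem v hv).resolve_left hvr)
        -- Exactly `r` leaves the set of vertices with unknown successors.
        · have hU : State.unknown ⟨Function.update τ₂.num 8 (T \ {r}).card, τ₂.vert, τ₂.edge, τ₂.out,
              τ₂.ops + 1, τ₂.vertRegs, τ₂.edgeRegs⟩ idx + 1 = τ.unknown idx := by
            simp only [State.unknown]
            rw [← Finset.card_erase_add_one
              (show r ∈ Finset.univ.filter fun v => τ.st idx v = 0 by simpa using hst)]
            congr 2
            ext u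
            rw [Finset.mem_filter, Finset.mem_erase, Finset.mem_filter]
            change _ ∧ Function.update τ₂.num 8 (T \ {r}).card (16 + 3 * idx u) = 0 ↔ _
            rw [hst₃]
            split_ifs with hur
            · simp [hur]
            · simp [hur]
          rw [← hU, Nat.mul_succ] at hops
          have hNh : (L + 3) * N.card ≤ (L + 3) * (2 * h) := Nat.mul_le_mul_left _ (by omega)
          omega
  · rintro τ ⟨hF, h8, hsub, hK', hdeg, hops⟩ hc
    simp only [eval_x, h8, Finset.card_eq_zero] at hc
    refine ⟨hF, hK', fun v hv => hdeg v hv (by simp [hc]), ?_⟩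
    omega
  · simp only [runs_seq, runs_sym, runs_assign, runs_skip, Instr.step, Instr.effect, State.setNum,
      State.setVert, SetOp.eval, eval_lit, eval_x, Function.update_self, Function.update_of_ne,
      ne_eq, Nat.reduceEqDiff, not_false_eq_true, hA, Finset.union_self]
    have hst₂ : ∀ u, Function.update σ.num 8 A.card (16 + 3 * idx u) = σ.st idx u := fun u => by
      rw [Function.update_of_ne (by omega)]
      rfl
    have hadj₂ : ∀ u w, Function.update σ.num 8 A.card
        (18 + 3 * (idx u * Fintype.card V + idx w)) = σ.adj idx u w := fun u w => by
      rw [Function.update_of_ne (by omega)]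
      rfl
    refine ⟨(Frame.refl _ _ σ).extend, trivial, subset_rfl, ⟨?_, ?_, ?_, ?_⟩,
      fun v hv hv' => absurd hv hv', ?_⟩
    · simpa only [State.st, hst₂] using hK.le_two
    · simpa only [State.st, hst₂] using hK.eq_two
    · simpa only [State.adj, hadj₂] using hK.sound
    · simpa only [State.st, State.adj, hst₂, hadj₂] using hK.complete
    · rw [State.unknown_mk (σ := σ) hst₂]
      omega

end Symbolic

/-! ## One round of the main loop -/

namespace Symbolic

set_option linter.unusedSimpArgs false
set_option linter.flexible false

variable {V : Type*} [Fintype V] [DecidableEq V] {choice : ℕ → Finset V → V}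

/-- The invariant of the main loop. -/
structure Inv (P : MDP V) (L h : ℕ) (idx : V → ℕ) (σ : State V) : Prop where
  env : Env P L h idx σ
  part : P.Partial (σ.vert 3) (σ.vert 9) σ.out
  known : Known P idx (σ.vert 3) σ
  card : σ.num 5 = (σ.vert 3).card
  -- Subtraction-free form of: more than `2 * h` successors at the last refresh, minus at most one
  -- for each vertex decided since.
  deg : ∀ v ∈ σ.vert 3, σ.st idx v = 0 →
    2 * h + (σ.vert 3).card < (post P.edges {v} ∩ σ.vert 3).card + σ.num 4

/-- A bound for `h` times the number of operations; it does not grow in the main loop. -/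
def potential (L h : ℕ) (idx : V → ℕ) (σ : State V) : ℕ :=
  -- The terms after the first pay for refreshes, symbolic searches, the work per decided vertex,
  -- and the recording of rows, in this order.
  h * σ.ops + (L + 8) * Fintype.card V * σ.num 4 + 11 * Fintype.card V * (σ.vert 3).card +
    h * (2 * L + 26) * (σ.vert 3).card + h * ((L + 3) * (2 * h) * σ.unknown idx)

/-- Refreshes if many vertices have been decided since the last time. -/
def refreshIfDue : Stmt :=
  .ite (x 4 + lit 1 - (x 5 + x 3)) (block [refresh, .assign (lit 4) (x 5)]) .skip

/-- A refresh that is due lowers register 4 by at least `h`. This releases `(L + 8) * n * h` of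
potential, enough for `h` times the at most `(L + 8) * n` operations besides the rows. -/
theorem refreshIfDue_spec (hch : ∀ t X, X.Nonempty → choice t X ∈ X)
    {P : MDP V} {L h : ℕ} {idx : V → ℕ} (hn : Numbering L idx) (hh : 0 < h) {σ : State V}
    (hI : Inv P L h idx σ) (hne : (σ.vert 3).Nonempty) :
    Runs choice refreshIfDue σ fun τ => Inv P L h idx τ ∧ τ.vert 3 = σ.vert 3 ∧
      τ.num 4 < (τ.vert 3).card + h ∧ potential L h idx τ ≤ potential L h idx σ := by
  simp only [refreshIfDue, block, runs_ite, runs_seq, runs_skip, runs_assign, eval_sub, eval_add,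
    eval_x, eval_lit, hI.env.thr, hI.card]
  refine ⟨fun hc => ?_, fun hc => ⟨hI, trivial, by omega, le_rfl⟩⟩
  refine Runs.mono (refresh_spec hch hn hI.env rfl hI.known) ?_
  rintro τ ⟨hF, hK, hdeg, hops⟩
  have h3 : τ.vert 3 = σ.vert 3 := hF.vert 3 (by omega)
  have h5 : τ.num 5 = (σ.vert 3).card := by rw [hF.num 5 (by omega), hI.card]
  have h9 : τ.vert 9 = σ.vert 9 := hF.vert 9 (by omega)
  have hst : ∀ u, Function.update τ.num 4 (τ.num 5) (16 + 3 * idx u) = τ.st idx u := fun u => by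
    rw [Function.update_of_ne (by omega)]
    rfl
  have hadj : ∀ u w, Function.update τ.num 4 (τ.num 5)
      (18 + 3 * (idx u * Fintype.card V + idx w)) = τ.adj idx u w := fun u w => by
    rw [Function.update_of_ne (by omega)]
    rfl
  have hF4 := hF.mono (N' := fun a => (4 ≤ a ∧ a ≤ 13) ∨ (16 ≤ a ∧ a % 3 ≠ 2))
    (by intros; omega) (fun a ha => ha)
  refine ⟨⟨hI.env.of_frame hF4.extend (by intros; omega) (by intros; omega), ?_,
    ⟨?_, ?_, ?_, ?_⟩, ?_, ?_⟩, h3, ?_, ?_⟩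
  · simpa only [State.setNum, h3, h9, hF.out] using hI.part
  · simpa only [State.setNum, State.st, hst, h3] using hK.le_two
  · simpa only [State.setNum, State.st, hst, h3] using hK.eq_two
  · simpa only [State.setNum, State.adj, hadj, h3] using hK.sound
  · simpa only [State.setNum, State.st, State.adj, hst, hadj, h3] using hK.complete
  · simp [State.setNum, h3, h5]
  · intro v hv hv0
    have h1 := hdeg v (h3 ▸ hv) (by simpa only [State.setNum, State.st, hst] using hv0)
    simp [State.setNum, h3, h5]
    omega
  · simp [State.setNum, h3, h5]
    omega
  · have hU : (τ.setNum 4 (τ.num 5)).unknown idx = τ.unknown idx := State.unknown_mk hst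
    have h4' : (τ.setNum 4 (τ.num 5)).num 4 = (σ.vert 3).card := by simp [State.setNum, h5]
    have hv3' : (τ.setNum 4 (τ.num 5)).vert 3 = σ.vert 3 := h3
    have hops' : (τ.setNum 4 (τ.num 5)).ops = τ.ops := rfl
    unfold potential
    rw [hU, h4', hv3', hops']
    have ha : (σ.vert 3).card ≤ Fintype.card V := Finset.card_le_univ _
    have ha1 : 1 ≤ (σ.vert 3).card := Finset.card_pos.2 hne
    have e1 : 2 + (L + 6) * (σ.vert 3).card ≤ (L + 8) * Fintype.card V := by
      calc 2 + (L + 6) * (σ.vert 3).card ≤ (L + 8) * (σ.vert 3).card := by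
            rw [show L + 8 = (L + 6) + 2 by ring, Nat.add_mul (L + 6) 2]; omega
        _ ≤ _ := Nat.mul_le_mul_left _ ha
    have e2 := Nat.mul_le_mul_left h hops
    have e3 := Nat.mul_le_mul_left h e1
    have e4 : (L + 8) * Fintype.card V * ((σ.vert 3).card + h) ≤
        (L + 8) * Fintype.card V * σ.num 4 := Nat.mul_le_mul_left _ (by omega)
    rw [Nat.mul_add] at e4
    rw [Nat.mul_comm h ((L + 8) * Fintype.card V)] at e3
    simp only [Nat.mul_add] at e2 e3 ⊢
    omega

/-- Stores a vertex of a bottom component of the undecided vertices in register `4`. -/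
def findRoot : Stmt := block [searchKnown, .ite (x 6) select searchRoot]

/-- The expensive alternative comes with a vertex `u` of unknown successors reachable from the root;
it will show that the component is large. -/
theorem findRoot_spec (hch : ∀ t X, X.Nonempty → choice t X ∈ X)
    {P : MDP V} {L h : ℕ} {idx : V → ℕ} (hn : Numbering L idx) {σ : State V}
    (hE : Env P L h idx σ) {A : Finset V} (hA : σ.vert 3 = A) (hne : A.Nonempty)
    (hK : Known P idx A σ) :
    Runs choice findRoot σ fun τ =>
      Frame (fun a => (6 ≤ a ∧ a ≤ 15) ∨ (17 ≤ a ∧ a % 3 = 2))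
        (fun a => a = 4 ∨ a = 5 ∨ a = 8) σ τ ∧
      ∃ r, τ.vert 4 = {r} ∧ P.IsRoot A r ∧ (τ.ops ≤ σ.ops + (L + 1) ∨
        (τ.ops ≤ σ.ops + 2 + 9 * A.card ∧ ∃ u ∈ A, σ.st idx u = 0 ∧ P.Reach A r u)) := by
  simp only [findRoot, block, runs_seq, runs_skip]
  refine Runs.mono (searchKnown_spec hn hE hK) ?_
  rintro σ₁ ⟨hF₁, hops₁, hcase⟩
  have hE₁ := hE.of_frame hF₁ (by intros; omega) (by simp)
  have hA₁ : σ₁.vert 3 = A := by rw [hF₁.vert 3 (by simp), hA]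
  have hF₁' := hF₁.mono (N' := fun a => (6 ≤ a ∧ a ≤ 15) ∨ (17 ≤ a ∧ a % 3 = 2))
    (W' := fun a => a = 4 ∨ a = 5 ∨ a = 8) (by intros; omega) (by simp)
  simp only [runs_ite, eval_x]
  constructor
  · intro h6
    rcases hcase with ⟨h0, -⟩ | ⟨r, hr6, hr⟩
    · exact absurd h0 h6
    · refine Runs.mono (select_spec hn hE₁ (hA₁ ▸ hr.1) hr6) ?_
      rintro τ ⟨hF, h4, hops⟩
      exact ⟨hF₁'.trans (hF.mono (by intros; omega) (by intros; omega)), r, h4, hr,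
        Or.inl (by omega)⟩
  · intro h6
    refine Runs.mono (searchRoot_spec hch hE₁ hA₁ hne) ?_
    rintro τ ⟨hF, ⟨r, h4, hr⟩, hops⟩
    refine ⟨hF₁'.trans (hF.mono (by intros; omega) (by intros; omega)), r, h4, hr, ?_⟩
    rcases hcase with ⟨-, h0⟩ | ⟨r', hr6, -⟩
    · exact Or.inr ⟨by omega, h0 r hr.1⟩
    · omega

/-- Finds one MEC and removes it. -/
def iteration : Stmt := block [
  refreshIfDue, findRoot, component, .sym (.emit (lit 7)), removeComponent, markDecided,
  .sym (.card (lit 5) (lit 3))]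

theorem iteration_spec (hch : ∀ t X, X.Nonempty → choice t X ∈ X)
    {P : MDP V} {L h : ℕ} {idx : V → ℕ} (hn : Numbering L idx) (hh : 0 < h) {σ : State V}
    (hI : Inv P L h idx σ) (hne : (σ.vert 3).Nonempty) :
    Runs choice iteration σ fun τ => Inv P L h idx τ ∧ (τ.vert 3).card < (σ.vert 3).card ∧
      potential L h idx τ ≤ potential L h idx σ := by
  simp only [iteration, block, runs_seq, runs_skip, runs_sym]
  refine Runs.mono (refreshIfDue_spec hch hn hh hI hne) ?_
  rintro σ₁ ⟨hI₁, h31, h41, hpot⟩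
  rw [← h31] at hne ⊢
  set A := σ₁.vert 3 with hA
  refine Runs.mono (findRoot_spec hch hn hI₁.env rfl hne hI₁.known) ?_
  rintro σ₂ ⟨hF₂, r, h4, hr, hcost⟩
  have hE₂ := hI₁.env.of_frame hF₂ (by intros; omega) (by intros; omega)
  refine Runs.mono (component_spec hE₂ (A := A) (by rw [hF₂.vert 3 (by omega)]) hr.1 h4) ?_
  rintro σ₃ ⟨hF₃', hC, hops₃⟩
  have hF₃ := (hF₂.mono (W' := fun a => a = 4 ∨ a = 5 ∨ a = 7 ∨ a = 8) (fun a ha => ha)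
    (by intros; omega)).trans (hF₃'.mono (by intros; omega) (by intros; omega))
  have hE₃ := hI₁.env.of_frame hF₃ (by intros; omega) (by intros; omega)
  set C := σ₃.vert 7 with hCdef
  have hops₃' : σ₃.ops ≤ σ₂.ops + 3 + 5 * C.card := hops₃
  set σ₄ := Instr.step choice (.emit (lit 7)) σ₃ with hσ₄
  have hE₄ : Env P L h idx σ₄ := ⟨hE₃.card, hE₃.bits, hE₃.thr, hE₃.edge, hE₃.random, hE₃.bit,
    hE₃.vertRegs, hE₃.edgeRegs⟩
  have hops₄ : σ₄.ops = σ₃.ops + 1 := rfl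
  refine Runs.mono (removeComponent_spec hE₄ hI₁.part hr hC (hF₃.vert 3 (by omega)) rfl
    (hF₃.vert 9 (by omega))) ?_
  rintro σ₅ ⟨hF₅, hpart, hsub, hD, hCD, hops₅⟩
  have hE₅ := hE₄.of_frame hF₅ (by intros; omega) (by intros; omega)
  refine Runs.mono (markDecided_spec hch hn hE₅ hD) ?_
  rintro τ ⟨hF₆, hst₆, hops₆⟩
  have hE₆ := hE₅.of_frame hF₆ (by intros; omega) (by intros; omega)
  rw [hD] at hops₅
  set A' := σ₅.vert 3 with hA'
  rw [← hA] at hsub hst₆ hops₆ hops₅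
  have h3 : τ.vert 3 = A' := hF₆.vert 3 (by omega)
  have h9 : τ.vert 9 = σ₅.vert 9 := hF₆.vert 9 (by omega)
  have hout : τ.out = σ₁.out ++ [C] := by
    rw [hF₆.out, hF₅.out, ← hF₃.out]
    rfl
  have h4τ : τ.num 4 = σ₁.num 4 := by
    rw [hF₆.num 4 (by omega), hF₅.num 4 (by omega)]
    exact hF₃.num 4 (by omega)
  have hst : ∀ v, τ.st idx v = if v ∈ A \ A' then 2 else σ₁.st idx v := by
    intro v
    rw [hst₆ v]
    refine if_congr Iff.rfl rfl ?_
    rw [State.st, hF₅.num _ (by omega)]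
    exact hF₃.num _ (by omega)
  have hadj : ∀ v w, τ.adj idx v w = σ₁.adj idx v w := by
    intro v w
    rw [State.adj, hF₆.num _ (by omega), hF₅.num _ (by omega)]
    exact hF₃.num _ (by omega)
  have hcard : (A \ A').card + A'.card = A.card := Finset.card_sdiff_add_card_eq_card hsub
  have hCA : C.card ≤ (A \ A').card := Finset.card_le_card (hD ▸ hCD)
  have hCpos : 0 < C.card := Finset.card_pos.2 ⟨r, (hC r).2 .refl⟩
  simp only [runs_seq, runs_sym, runs_assign, runs_skip, Instr.step, Instr.effect, State.setNum,
    State.setVert, SetOp.eval, eval_lit, eval_x, Function.update_self, Function.update_of_ne, ne_eq,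
    Nat.reduceEqDiff, not_false_eq_true, h3]
  have hst' : ∀ v, Function.update τ.num 5 A'.card (16 + 3 * idx v) = τ.st idx v := fun v => by
    rw [Function.update_of_ne (by omega)]
    rfl
  have hadj' : ∀ v w, Function.update τ.num 5 A'.card
      (18 + 3 * (idx v * Fintype.card V + idx w)) = τ.adj idx v w := fun v w => by
    rw [Function.update_of_ne (by omega)]
    rfl
  refine ⟨⟨?_, ?_, ?_, ?_, ?_⟩, by omega, ?_⟩
  · exact hE₆.of_frame ((Frame.refl (fun a => a = 5) (fun _ => False) τ).extend)
      (by intros; omega) (by simp)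
  · simpa only [h3, h9, hout] using hpart
  · change Known P idx (τ.vert 3) _
    rw [h3]
    exact hI₁.known.restrict hsub (fun v => (hst' v).trans (hst v))
      (fun v w => (hadj' v w).trans (hadj v w))
  · simp [h3]
  · intro v hv hv0
    change 2 * h + (τ.vert 3).card < (post P.edges {v} ∩ τ.vert 3).card +
      Function.update τ.num 5 A'.card 4
    change v ∈ τ.vert 3 at hv
    rw [h3] at hv ⊢
    rw [Function.update_of_ne (by omega), h4τ]
    have hv1 : σ₁.st idx v = 0 := by
      have h1 : τ.st idx v = 0 := (hst' v).symm.trans hv0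
      rwa [hst v, if_neg (by simp [hv])] at h1
    have h1 : 2 * h + A.card < (post P.edges {v} ∩ A).card + σ₁.num 4 :=
      hI₁.deg v (hsub hv) hv1
    -- The degree drops by at most the number of removed vertices, which is exactly the drop of the
    -- cardinality on the other side.
    have h2 : (post P.edges {v} ∩ A).card ≤ (post P.edges {v} ∩ A').card + (A \ A').card := by
      refine (Finset.card_le_card fun w hw => ?_).trans (Finset.card_union_le _ _)
      simp only [Finset.mem_union, Finset.mem_inter, Finset.mem_sdiff] at hw ⊢
      tauto
    omega
  · refine le_trans ?_ hpot
    have hU : State.unknown ⟨Function.update τ.num 5 A'.card, τ.vert, τ.edge, τ.out,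
        τ.ops + 1, τ.vertRegs, τ.edgeRegs⟩ idx ≤ σ₁.unknown idx := by
      refine Finset.card_le_card fun v hv => ?_
      rw [Finset.mem_filter] at hv ⊢
      have h1 : τ.st idx v = 0 := (hst' v).symm.trans hv.2
      rw [hst v] at h1
      split_ifs at h1
      exact ⟨hv.1, h1⟩
    have e1 := Nat.mul_le_mul_left h (Nat.mul_le_mul_left ((L + 3) * (2 * h)) hU)
    have hn4 : Function.update τ.num 5 A'.card 4 = σ₁.num 4 := by
      rw [Function.update_of_ne (by omega), h4τ]
    unfold potential
    simp only [hn4, h3, ← hA]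
    set d := (A \ A').card with hd
    -- The left side adds up the steps of a round with a numerically found root: `L + 11` fixed
    -- operations and `5 + 7 + (L + 3)` per removed vertex.
    have hcheap : L + 11 + (L + 15) * d ≤ (2 * L + 26) * d := by
      have h1 : L + 11 ≤ (L + 11) * d := Nat.le_mul_of_pos_right _ (by omega)
      have h2 : (2 * L + 26) * d = (L + 11) * d + (L + 15) * d := by ring
      omega
    have hmul : (L + 15) * d = (L + 3) * d + 12 * d := by ring
    have hAn : A.card ≤ Fintype.card V := Finset.card_le_univ _
    have hApos : 0 < A.card := Finset.card_pos.2 hne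
    have hsplit : ∀ k, k * A.card = k * d + k * A'.card := fun k => by
      rw [← hcard, Nat.mul_add]
    rw [hsplit (11 * Fintype.card V), hsplit (h * (2 * L + 26))]
    rcases hcost with hcost | ⟨hcost, u, huA, hu0, hru⟩
    · have e2 : τ.ops + 1 ≤ σ₁.ops + (2 * L + 26) * d := by omega
      have e3 : h * (τ.ops + 1) ≤ h * σ₁.ops + h * (2 * L + 26) * d :=
        (Nat.mul_le_mul_left h e2).trans_eq (by ring)
      omega
    · rw [← hA] at hcost
      have hdeg : 2 * h + A.card < (post P.edges {u} ∩ A).card + σ₁.num 4 := hI₁.deg u huA hu0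
      -- As `u` is reachable from `r`, its undecided successors all lie in `C`. There are more than
      -- `h` of them, since fewer than `h` vertices have been decided since the last refresh.
      have hpC : (post P.edges {u} ∩ A).card ≤ C.card := by
        refine Finset.card_le_card fun w hw => ?_
        simp only [post, Finset.mem_inter, Finset.mem_filter, Finset.mem_univ, true_and,
          Finset.mem_singleton, exists_eq_left] at hw
        exact (hC w).2 (hru.tail ⟨huA, hw.2, hw.1⟩)
      have hhd : h ≤ d := by omega
      have e2 : τ.ops + 1 ≤ σ₁.ops + (2 * L + 26) * d + 11 * Fintype.card V := by omega
      have e3 : h * (τ.ops + 1) ≤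
          h * σ₁.ops + h * (2 * L + 26) * d + h * (11 * Fintype.card V) :=
        (Nat.mul_le_mul_left h e2).trans_eq (by ring)
      -- The removal of at least `h` vertices pays for the symbolic search.
      have e5 : h * (11 * Fintype.card V) ≤ 11 * Fintype.card V * d := by
        rw [Nat.mul_comm]
        exact Nat.mul_le_mul_left _ hhd
      omega

end Symbolic

/-! ## Initialization -/

namespace Symbolic

set_option linter.unusedSimpArgs false
set_option linter.flexible false

variable {V : Type*} [Fintype V] [DecidableEq V] {choice : ℕ → Finset V → V}

/-- Puts the number of vertices into the numeric register `1`, its binary logarithm into `2` and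
its square root into `3`, rounded up. -/
def setupSizes : Stmt := block [
  .sym (.card (lit 1) (lit 0)),
  .assign (lit 2) (lit 0),
  .assign (lit 8) (lit 1),
  .loop (x 1 - x 8) (block [
    .assign (lit 2) (x 2 + lit 1),
    .assign (lit 8) (x 8 * lit 2)]),
  .assign (lit 3) (lit 0),
  .loop (x 1 - x 3 * x 3) (.assign (lit 3) (x 3 + lit 1))]

/-- Doubling overshoots by a factor of at most 2. The last increment of the root starts from `h * h
< n`, and `h ≤ h * h` keeps the new square below `4 * n`. -/
theorem setupSizes_spec [Nonempty V] {σ : State V} (h0 : σ.vert 0 = Finset.univ) :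
    Runs choice setupSizes σ fun τ =>
      Frame (fun a => a = 1 ∨ a = 2 ∨ a = 3 ∨ a = 8) (fun _ => False) σ τ ∧
      τ.num 1 = Fintype.card V ∧ τ.ops = σ.ops + 1 ∧
      Fintype.card V ≤ 2 ^ τ.num 2 ∧ 2 ^ τ.num 2 ≤ 2 * Fintype.card V ∧
      Fintype.card V ≤ τ.num 3 * τ.num 3 ∧ τ.num 3 * τ.num 3 ≤ 4 * Fintype.card V := by
  have hpos : 0 < Fintype.card V := Fintype.card_pos
  simp only [setupSizes, block, runs_seq, runs_assign, runs_skip, runs_sym]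
  refine runs_loop (fun τ => Frame (fun a => a = 1 ∨ a = 2 ∨ a = 3 ∨ a = 8) (fun _ => False) σ τ ∧
    τ.num 1 = Fintype.card V ∧ τ.ops = σ.ops + 1 ∧ τ.num 8 = 2 ^ τ.num 2 ∧
    2 ^ τ.num 2 ≤ 2 * Fintype.card V) (fun τ => Fintype.card V - τ.num 8) ?_ ?_ ?_
  · rintro τ ⟨hF, h1, hops, h8, h2⟩ hc
    simp only [eval_sub, eval_x, h1] at hc
    have hp : 0 < 2 ^ τ.num 2 := by positivity
    simp [h1, pow_succ]
    exact ⟨⟨hF.extend, hops, by omega, by omega⟩, by omega⟩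
  · rintro τ ⟨hF, h1, hops, h8, h2⟩ hc
    simp only [eval_sub, eval_x, h1] at hc
    refine runs_loop (fun τ' => Frame (fun a => a = 1 ∨ a = 2 ∨ a = 3 ∨ a = 8) (fun _ => False)
      σ τ' ∧ τ'.num 1 = Fintype.card V ∧ τ'.ops = σ.ops + 1 ∧ τ'.num 2 = τ.num 2 ∧
      τ'.num 3 * τ'.num 3 ≤ 4 * Fintype.card V) (fun τ' => Fintype.card V - τ'.num 3) ?_ ?_ ?_
    · rintro τ' ⟨hF', h1', hops', h2', h3'⟩ hc'
      simp only [eval_sub, eval_mul, eval_x, h1'] at hc'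
      have h5 : τ'.num 3 ≤ τ'.num 3 * τ'.num 3 := Nat.le_mul_self _
      simp [h1', h2']
      refine ⟨⟨hF'.extend, hops', ?_⟩, by omega⟩
      rw [show (τ'.num 3 + 1) * (τ'.num 3 + 1) = τ'.num 3 * τ'.num 3 + 2 * τ'.num 3 + 1 by ring]
      omega
    · rintro τ' ⟨hF', h1', hops', h2', h3'⟩ hc'
      simp only [eval_sub, eval_mul, eval_x, h1'] at hc'
      exact ⟨hF', h1', hops', by rw [h2']; omega, by rw [h2']; omega, by omega, h3'⟩
    · simp [h1, hops]
      exact hF.extend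
  · simp [h0, Finset.card_univ]
    exact ⟨(Frame.refl _ _ σ).extend, by omega⟩

/-- The variant of `Frame` for statements that also reserve the registers `11 + i` for `i < L`. -/
structure BitFrame (L : ℕ) (N W : ℕ → Prop) (σ τ : State V) : Prop where
  num : ∀ a, ¬ N a → τ.num a = σ.num a
  vert : ∀ a, a < 11 → ¬ W a → τ.vert a = σ.vert a
  edge : τ.edge = σ.edge
  out : τ.out = σ.out
  vertRegs : τ.vertRegs ≤ max σ.vertRegs (11 + L)
  edgeRegs : τ.edgeRegs = σ.edgeRegs

/-- Adds the vertex in register `4` to the bit sets of the number in the numeric register `14`. -/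
def addBits : Stmt := block [
  .assign (lit 13) (x 14),
  .assign (lit 11) (lit 0),
  .loop (x 2 - x 11) (block [
    .ite (x 13 - lit 2 * (x 13 / lit 2))
      (.sym (.vertOp .union (lit 11 + x 11) (lit 11 + x 11) (lit 4))) .skip,
    .assign (lit 13) (x 13 / lit 2),
    .assign (lit 11) (x 11 + lit 1)])]

theorem addBits_spec {σ : State V} {L : ℕ} (h2 : σ.num 2 = L) :
    Runs choice addBits σ fun τ =>
      BitFrame L (fun a => 11 ≤ a ∧ a ≤ 13) (fun _ => False) σ τ ∧
      (∀ i < L, ∀ v, v ∈ τ.vert (11 + i) ↔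
        v ∈ σ.vert (11 + i) ∨ v ∈ σ.vert 4 ∧ (σ.num 14).testBit i = true) ∧
      τ.ops ≤ σ.ops + L := by
  simp only [addBits, block, runs_seq, runs_assign, runs_skip]
  refine runs_loop (fun τ => BitFrame L (fun a => 11 ≤ a ∧ a ≤ 13) (fun _ => False) σ τ ∧
    τ.num 11 ≤ L ∧ τ.num 13 = σ.num 14 / 2 ^ τ.num 11 ∧
    (∀ i, ∀ v, v ∈ τ.vert (11 + i) ↔ v ∈ σ.vert (11 + i) ∨
      i < τ.num 11 ∧ v ∈ σ.vert 4 ∧ (σ.num 14).testBit i = true) ∧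
    τ.ops ≤ σ.ops + τ.num 11) (fun τ => L - τ.num 11) ?_ ?_ ?_
  · rintro τ ⟨hF, h1, h3, h4, h5⟩ hc
    have h2' : τ.num 2 = L := by rw [hF.num 2 (by omega), h2]
    have hv4 : τ.vert 4 = σ.vert 4 := hF.vert 4 (by omega) (by simp)
    simp only [eval_sub, eval_x, h2'] at hc
    have hi : τ.num 11 < L := by omega
    have hb : ((σ.num 14).testBit (τ.num 11)).toNat = τ.num 13 % 2 := by
      rw [Nat.toNat_testBit, h3]
    have hm : τ.num 13 - 2 * (τ.num 13 / 2) = τ.num 13 % 2 := by omega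
    have hdiv : τ.num 13 / 2 = σ.num 14 / 2 ^ (τ.num 11 + 1) := by
      rw [h3, Nat.div_div_eq_div_mul, pow_succ]
    have hnum : ∀ a, ¬ (11 ≤ a ∧ a ≤ 13) → Function.update (Function.update τ.num 13
        (σ.num 14 / 2 ^ (τ.num 11 + 1))) 11 (τ.num 11 + 1) a = σ.num a := fun a ha => by
      rw [Function.update_of_ne (by omega), Function.update_of_ne (by omega), hF.num a ha]
    simp only [runs_seq, runs_ite, runs_assign, runs_skip, runs_sym]
    constructor
    · intro hc2
      simp [hm] at hc2
      have hb' : (σ.num 14).testBit (τ.num 11) = true := by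
        cases hh : (σ.num 14).testBit (τ.num 11)
        · simp [hh] at hb; omega
        · rfl
      simp [hdiv, hv4]
      refine ⟨⟨⟨hnum, fun a ha _ => ?_, hF.edge, hF.out, ?_, hF.edgeRegs⟩, hi, ?_, by omega⟩,
        by omega⟩
      · change Function.update _ _ _ _ = _
        rw [Function.update_of_ne (by omega), hF.vert a ha (by simp)]
      · have := hF.vertRegs
        change max τ.vertRegs _ ≤ _
        omega
      · intro i v
        by_cases hiv : i = τ.num 11
        · subst hiv
          simp [h4, hb']
        · rw [Function.update_of_ne (by omega), h4, show i ≤ τ.num 11 ↔ i < τ.num 11 by omega]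
    · intro hc2
      simp [hm] at hc2
      have hb' : (σ.num 14).testBit (τ.num 11) = false := by
        cases hh : (σ.num 14).testBit (τ.num 11)
        · rfl
        · simp [hh] at hb; omega
      simp [hdiv]
      refine ⟨⟨⟨hnum, hF.vert, hF.edge, hF.out, hF.vertRegs, hF.edgeRegs⟩, hi, ?_, by omega⟩,
        by omega⟩
      intro i v
      by_cases hiv : i = τ.num 11
      · subst hiv
        simp [h4, hb']
      · rw [h4, show i ≤ τ.num 11 ↔ i < τ.num 11 by omega]
  · rintro τ ⟨hF, h1, h3, h4, h5⟩ hc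
    have h2' : τ.num 2 = L := by rw [hF.num 2 (by omega), h2]
    simp only [eval_sub, eval_x, h2'] at hc
    have hi : τ.num 11 = L := by omega
    rw [hi] at h4 h5
    refine ⟨hF, fun i hiL v => ?_, h5⟩
    rw [h4]
    simp [hiL]
  · simp
    refine ⟨fun a ha => ?_, fun _ _ _ => rfl, rfl, rfl, le_max_left _ _, rfl⟩
    change Function.update (Function.update σ.num _ _) _ _ _ = _
    rw [Function.update_of_ne (by omega), Function.update_of_ne (by omega)]

/-- Numbers the vertices, and stores the bits of their numbers. -/
def numberVertices : Stmt := block [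
  .sym (.vertOp .union (lit 5) (lit 0) (lit 0)),
  .assign (lit 14) (lit 0),
  .sym (.card (lit 8) (lit 5)),
  .loop (x 8) (block [
    .sym (.pick (lit 4) (lit 5)),
    .sym (.vertOp .diff (lit 5) (lit 5) (lit 4)),
    addBits,
    .assign (lit 14) (x 14 + lit 1),
    .sym (.card (lit 8) (lit 5))])]

theorem numberVertices_spec (hch : ∀ t X, X.Nonempty → choice t X ∈ X) {σ : State V} {L : ℕ}
    (h0 : σ.vert 0 = Finset.univ) (h2 : σ.num 2 = L) (hL : Fintype.card V ≤ 2 ^ L)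
    (hbits : ∀ i, σ.vert (11 + i) = ∅) :
    Runs choice numberVertices σ fun τ =>
      BitFrame L (fun a => 8 ≤ a ∧ a ≤ 14) (fun a => a = 4 ∨ a = 5) σ τ ∧
      (∃ idx : V → ℕ, Numbering L idx ∧
        ∀ i < L, ∀ v, v ∈ τ.vert (11 + i) ↔ (idx v).testBit i = true) ∧
      τ.ops ≤ σ.ops + 2 + (L + 3) * Fintype.card V := by
  simp only [numberVertices, block, runs_seq, runs_assign, runs_skip, runs_sym]
  refine runs_loop (fun τ => BitFrame L (fun a => 8 ≤ a ∧ a ≤ 14) (fun a => a = 4 ∨ a = 5) σ τ ∧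
    τ.num 8 = (τ.vert 5).card ∧ τ.num 14 + (τ.vert 5).card = Fintype.card V ∧
    -- `f` is the numbering of the vertices already taken out of register 5; its other values are
    -- irrelevant.
    (∃ f : V → ℕ, (∀ v ∉ τ.vert 5, f v < τ.num 14) ∧
      (∀ v ∉ τ.vert 5, ∀ w ∉ τ.vert 5, f v = f w → v = w) ∧
      ∀ i < L, ∀ v, v ∈ τ.vert (11 + i) ↔ v ∉ τ.vert 5 ∧ (f v).testBit i = true) ∧
    τ.ops ≤ σ.ops + 2 + (L + 3) * τ.num 14) (fun τ => (τ.vert 5).card) ?_ ?_ ?_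
  · rintro τ ⟨hF, h8, h14, ⟨f, hf1, hf2, hf3⟩, hops⟩ hc
    simp only [eval_x, h8] at hc
    have hne : (τ.vert 5).Nonempty := Finset.card_pos.1 (by omega)
    set r := choice τ.ops (τ.vert 5) with hr
    have hr5 : r ∈ τ.vert 5 := hch _ _ hne
    set T := τ.vert 5 with hT
    simp only [runs_seq, runs_sym, runs_assign, runs_skip, Instr.step, Instr.effect, State.setNum,
      State.setVert, SetOp.eval, eval_lit, eval_x, Function.update_self, Function.update_of_ne,
      ne_eq, Nat.reduceEqDiff, not_false_eq_true, ← hT, if_pos hne, ← hr]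
    have h2' : τ.num 2 = L := by rw [hF.num 2 (by omega), h2]
    refine Runs.mono (addBits_spec (L := L) h2') ?_
    rintro υ ⟨hG, hb, hopsυ⟩
    have h14υ : υ.num 14 = τ.num 14 := hG.num 14 (by omega)
    have h5υ : υ.vert 5 = T \ {r} := by
      rw [hG.vert 5 (by omega) (by simp)]
      simp
    have hcard : (T \ {r}).card + 1 = T.card := by
      rw [Finset.sdiff_singleton_eq_erase, Finset.card_erase_add_one hr5]
    simp only [runs_seq, runs_sym, runs_assign, runs_skip, Instr.step, Instr.effect, State.setNum,
      State.setVert, SetOp.eval, eval_lit, eval_x, Function.update_self, Function.update_of_ne,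
      ne_eq, Nat.reduceEqDiff, not_false_eq_true, h5υ, eval_add, h14υ]
    refine ⟨⟨⟨?_, ?_, ?_, ?_, ?_, ?_⟩, trivial, by omega, ⟨fun v => if v = r then τ.num 14 else f v,
      ?_, ?_, ?_⟩, ?_⟩, by omega⟩
    · intro a ha
      change Function.update (Function.update _ _ _) _ _ _ = _
      rw [Function.update_of_ne (by omega), Function.update_of_ne (by omega), hG.num a (by omega)]
      exact hF.num a ha
    · intro a ha ha'
      refine (hG.vert a ha (by simp)).trans ?_
      change Function.update (Function.update _ _ _) _ _ _ = _
      rw [Function.update_of_ne (by omega), Function.update_of_ne (by omega)]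
      exact hF.vert a ha ha'
    · exact hG.edge.trans hF.edge
    · exact hG.out.trans hF.out
    · have h1 := hG.vertRegs
      have h2 := hF.vertRegs
      dsimp only at h1 ⊢
      omega
    · exact hG.edgeRegs.trans hF.edgeRegs
    · intro v hv
      simp only [Finset.mem_sdiff, Finset.mem_singleton, not_and, not_not] at hv
      beta_reduce
      split_ifs with hvr
      · omega
      · exact (hf1 v fun h => hvr (hv h)).trans (by omega)
    · intro v hv w hw hvw
      simp only [Finset.mem_sdiff, Finset.mem_singleton, not_and, not_not] at hv hw
      by_cases hvr : v = r <;> by_cases hwr : w = r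
      · rw [hvr, hwr]
      · have := hf1 w fun h => hwr (hw h)
        simp [hvr, hwr] at hvw
        omega
      · have := hf1 v fun h => hvr (hv h)
        simp [hvr, hwr] at hvw
        omega
      · simp only [if_neg hvr, if_neg hwr] at hvw
        exact hf2 v (fun h => hvr (hv h)) w (fun h => hwr (hw h)) hvw
    · intro i hi v
      rw [hb i hi v]
      change v ∈ Function.update (Function.update τ.vert 4 {r}) 5 (T \ {r}) (11 + i) ∨
        v ∈ Function.update (Function.update τ.vert 4 {r}) 5 (T \ {r}) 4 ∧
          (τ.num 14).testBit i = true ↔ _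
      rw [Function.update_of_ne (by omega), Function.update_of_ne (by omega),
        Function.update_of_ne (by omega), Function.update_self, hf3 i hi v]
      by_cases hvr : v = r
      · subst hvr
        simp [hr5]
      · simp [hvr]
    · rw [Nat.mul_add]
      dsimp only at hopsυ
      omega
  · rintro τ ⟨hF, h8, h14, ⟨f, hf1, hf2, hf3⟩, hops⟩ hc
    simp only [eval_x, h8, Finset.card_eq_zero] at hc
    simp only [hc, Finset.card_empty, Finset.notMem_empty, not_false_eq_true, true_and,
      forall_true_left] at h14 hf1 hf2 hf3
    rw [show τ.num 14 = Fintype.card V by omega] at hf1 hops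
    exact ⟨hF, ⟨f, ⟨fun v w => hf2 v w, hf1, hL⟩, hf3⟩, hops⟩
  · simp only [runs_seq, runs_sym, runs_assign, runs_skip, Instr.step, Instr.effect, State.setNum,
      State.setVert, SetOp.eval, eval_lit, eval_x, Function.update_self, Function.update_of_ne,
      ne_eq, Nat.reduceEqDiff, not_false_eq_true, h0, Finset.union_idempotent, Finset.mem_univ,
      not_true_eq_false, false_and]
    refine ⟨⟨?_, ?_, rfl, rfl, ?_, rfl⟩, trivial, ?_, ⟨fun _ => 0, ?_, ?_, ?_⟩, ?_⟩
    · intro a ha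
      change Function.update (Function.update _ _ _) _ _ _ = _
      rw [Function.update_of_ne (by omega), Function.update_of_ne (by omega)]
    · intro a _ ha'
      change Function.update _ _ _ _ = _
      rw [Function.update_of_ne (by omega)]
    · dsimp only
      omega
    · simp [Finset.card_univ]
    · simp
    · simp
    · intro i hi v
      rw [Function.update_of_ne (by omega), hbits]
      simp
    · omega

end Symbolic

/-! ## The program and its analysis -/

namespace Symbolic

set_option linter.unusedSimpArgs false
set_option linter.flexible false

variable {V : Type*} [Fintype V] [DecidableEq V] {choice : ℕ → Finset V → V}

/-- Prepares the main loop. -/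
def setup : Stmt := block [
  setupSizes,
  numberVertices,
  .sym (.vertOp .union (lit 3) (lit 0) (lit 0)),
  .assign (lit 4) (x 1 + lit 2 * x 3),
  .sym (.card (lit 5) (lit 3))]

theorem setup_spec (hch : ∀ t X, X.Nonempty → choice t X ∈ X) [Nonempty V] (P : MDP V) (k : ℕ) :
    Runs choice setup (init P k) fun τ => ∃ (L h : ℕ) (idx : V → ℕ), Numbering L idx ∧
      2 ^ L ≤ 2 * Fintype.card V ∧ Fintype.card V ≤ h * h ∧ h * h ≤ 4 * Fintype.card V ∧
      Inv P L h idx τ ∧ τ.vert 3 = Finset.univ ∧ τ.num 4 = Fintype.card V + 2 * h ∧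
      τ.ops ≤ (L + 3) * Fintype.card V + 5 := by
  simp only [setup, block, runs_seq, runs_skip]
  refine Runs.mono (setupSizes_spec rfl) ?_
  rintro σ₁ ⟨hF₁, h1, hops₁, hL, hL', hh, hh'⟩
  set L := σ₁.num 2 with hLdef
  set h := σ₁.num 3 with hhdef
  have hops₁' : σ₁.ops = 1 := hops₁
  refine Runs.mono (numberVertices_spec hch (L := L) (hF₁.vert 0 (by simp)) rfl hL
    (fun i => by
      rw [hF₁.vert _ (by simp)]
      simp only [init]
      rw [if_neg (by omega), if_neg (by omega), if_neg (by omega)])) ?_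
  rintro σ₂ ⟨hF₂, ⟨idx, hn, hbit⟩, hops₂⟩
  have hnum1 : σ₂.num 1 = Fintype.card V := (hF₂.num 1 (by omega)).trans h1
  have hnum2 : σ₂.num 2 = L := hF₂.num 2 (by omega)
  have hnum3 : σ₂.num 3 = h := hF₂.num 3 (by omega)
  have hv0 : σ₂.vert 0 = Finset.univ :=
    (hF₂.vert 0 (by omega) (by omega)).trans (hF₁.vert 0 (by simp))
  have hv2 : σ₂.vert 2 = P.random :=
    (hF₂.vert 2 (by omega) (by omega)).trans (hF₁.vert 2 (by simp))
  have hv9 : σ₂.vert 9 = ∅ := (hF₂.vert 9 (by omega) (by omega)).trans (hF₁.vert 9 (by simp))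
  have hedge : σ₂.edge 0 = P.edges := by rw [hF₂.edge, hF₁.edge]; rfl
  have hout : σ₂.out = [] := by rw [hF₂.out, hF₁.out]; rfl
  have hvr : σ₂.vertRegs ≤ 11 + L := by
    have h1 := hF₂.vertRegs
    have h2 : σ₁.vertRegs ≤ max 3 11 := hF₁.vertRegs
    omega
  have her : σ₂.edgeRegs = 1 := by rw [hF₂.edgeRegs, hF₁.edgeRegs]; rfl
  have harr : ∀ a, 16 ≤ a → σ₂.num a = 0 := fun a ha => by
    rw [hF₂.num a (by omega), hF₁.num a (by omega)]
    simp only [init]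
    exact if_neg (by omega)
  simp only [runs_seq, runs_sym, runs_assign, runs_skip, Instr.step, Instr.effect, State.setNum,
    State.setVert, SetOp.eval, eval_lit, eval_x, Function.update_self, Function.update_of_ne, ne_eq,
    Nat.reduceEqDiff, not_false_eq_true, eval_add, eval_mul, hv0, Finset.union_idempotent, hnum1,
    hnum3]
  have hst : ∀ a, 16 ≤ a → Function.update (Function.update σ₂.num 4 (Fintype.card V + 2 * h)) 5
      (Finset.univ : Finset V).card a = 0 := fun a ha => by
    rw [Function.update_of_ne (by omega), Function.update_of_ne (by omega), harr a ha]
  refine ⟨L, h, idx, hn, hL', hh, hh', ⟨⟨?_, ?_, ?_, hedge, ?_, ?_, ?_, her⟩, ?_,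
    ⟨?_, ?_, ?_, ?_⟩, ?_, ?_⟩, trivial, rfl, ?_⟩
  · simp [hnum1]
  · simp [hnum2]
  · simp [hnum3]
  · simp [hv2]
  · intro i hi v
    dsimp only
    rw [Function.update_of_ne (by omega)]
    exact hbit i hi v
  · dsimp only
    omega
  · simpa [hv9, hout] using P.partial_univ
  · intro v
    simp only [State.st, hst (16 + 3 * idx v) (by omega)]
    omega
  · intro v
    simp only [State.st, hst (16 + 3 * idx v) (by omega)]
    simp
  · intro v w hvw
    exact absurd (hst _ (by omega)) hvw
  · intro v hv
    simp only [State.st, hst (16 + 3 * idx v) (by omega)] at hv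
    omega
  · simp
  -- Register 4 starts at `n + 2 * h` instead of `n`: the degree invariant then asks only for one
  -- successor, and the first round is forced to refresh.
  · intro v _ _
    obtain ⟨w, hw⟩ := P.exists_succ v
    have : 0 < (post P.edges {v}).card := Finset.card_pos.2 ⟨w, by simpa [post] using hw⟩
    simp [Finset.card_univ]
    omega
  · rw [hops₁'] at hops₂
    omega

/-- Computes the MEC decomposition. -/
def mecDecomposition : Stmt := block [setup, .loop (x 5) iteration, .sym (.emit (lit 9))]

/-- By `n ≤ h * h`, the quadratic term `n * n` is at most `h` times `n * h`, so the factor `h`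
cancels throughout. With `L` and `h` at least 1 the groups of terms are multiples of `n * h * L`,
and 83 = 9 + 27 + 39 + 8. -/
theorem ops_le_of_potential_le {n L h u s t : ℕ} (hn : 0 < n) (hL : 0 < L) (hh : 0 < h)
    (hnh : n ≤ h * h) (hu : u ≤ n) (hs : s ≤ (L + 3) * n + 5)
    (ht : h * t ≤ h * s + (L + 8) * n * (n + 2 * h) + 11 * n * n + h * (2 * L + 26) * n +
      h * ((L + 3) * (2 * h) * u)) : t ≤ 83 * (n * h * L) := by
  refine Nat.le_of_mul_le_mul_left (ht.trans ?_) hh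
  have e1 : n * n ≤ h * (n * h) := by nlinarith
  have e2 : s ≤ 9 * (n * h * L) := by
    have h1 : n * L ≤ n * L * h := Nat.le_mul_of_pos_right _ hh
    have h2 : n * 1 ≤ n * (h * L) := Nat.mul_le_mul_left _ (Nat.mul_pos hh hL)
    nlinarith
  have e3 : (L + 8) * (n * h) + (L + 8) * (2 * n) ≤ 27 * (n * h * L) := by
    have h1 : n * h * 1 ≤ n * h * L := Nat.mul_le_mul_left _ hL
    have h2 : n * L ≤ n * L * h := Nat.le_mul_of_pos_right _ hh
    have h3 : n * 1 ≤ n * (h * L) := Nat.mul_le_mul_left _ (Nat.mul_pos hh hL)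
    nlinarith
  have e4 : 11 * (n * h) + (2 * L + 26) * n ≤ 39 * (n * h * L) := by
    have h1 : n * h * 1 ≤ n * h * L := Nat.mul_le_mul_left _ hL
    have h2 : n * L ≤ n * L * h := Nat.le_mul_of_pos_right _ hh
    have h3 : n * 1 ≤ n * (h * L) := Nat.mul_le_mul_left _ (Nat.mul_pos hh hL)
    nlinarith
  have e5 : (L + 3) * (2 * h) * u ≤ 8 * (n * h * L) := by
    have h1 : n * h * 1 ≤ n * h * L := Nat.mul_le_mul_left _ hL
    have h2 := Nat.mul_le_mul_left ((L + 3) * (2 * h)) hu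
    nlinarith
  have f2 := Nat.mul_le_mul_left h e2
  have f3 := Nat.mul_le_mul_left h e3
  have f4 := Nat.mul_le_mul_left h e4
  have f5 := Nat.mul_le_mul_left h e5
  have e6 := Nat.mul_le_mul_left (L + 8) e1
  have g1 : (L + 8) * n * (n + 2 * h) = (L + 8) * (n * n) + h * ((L + 8) * (2 * n)) := by ring
  have g2 : (L + 8) * (h * (n * h)) = h * ((L + 8) * (n * h)) := by ring
  have g3 : 11 * n * n = 11 * (n * n) := by ring
  have g4 : h * (2 * L + 26) * n = h * ((2 * L + 26) * n) := by ring
  have g5 : h * (11 * (n * h)) = 11 * (h * (n * h)) := by ring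
  rw [Nat.mul_add] at f3 f4
  rw [show h * (83 * (n * h * L)) = h * (9 * (n * h * L)) + h * (27 * (n * h * L)) +
    h * (39 * (n * h * L)) + h * (8 * (n * h * L)) by ring]
  omega

/-- The potential after the setup bounds `h` times the operations of the main loop's end state; the
final output raises 83 to 84. The space consists of `11 + L` vertex registers and one edge register.
-/
theorem mecDecomposition_spec (hch : ∀ t X, X.Nonempty → choice t X ∈ X) [Nonempty V]
    (P : MDP V) (k : ℕ) :
    Runs choice mecDecomposition (init P k) fun τ => P.IsMECDecomposition τ.out ∧
      ∃ L h, 2 ^ L ≤ 2 * Fintype.card V ∧ h * h ≤ 4 * Fintype.card V ∧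
        τ.ops ≤ 84 * (Fintype.card V * h * L) ∧ τ.space ≤ 12 + L := by
  simp only [mecDecomposition, block, runs_seq, runs_skip, runs_sym]
  refine Runs.mono (setup_spec hch P k) ?_
  rintro σ ⟨L, h, idx, hn, hL, hh, hh', hI, h3, h4, hops⟩
  have hcard := P.one_lt_card
  have hLpos : 0 < L := by
    rcases Nat.eq_zero_or_pos L with rfl | h0
    · have := hn.le_pow
      simp at this
      omega
    · exact h0
  have hhpos : 0 < h := by
    rcases Nat.eq_zero_or_pos h with rfl | h0
    · omega
    · exact h0
  refine runs_loop (fun τ => Inv P L h idx τ ∧ potential L h idx τ ≤ potential L h idx σ)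
    (fun τ => (τ.vert 3).card) ?_ ?_ ⟨hI, le_rfl⟩
  · rintro τ ⟨hI', hpot⟩ hc
    simp only [eval_x, hI'.card] at hc
    refine Runs.mono (iteration_spec hch hn hhpos hI' (Finset.card_pos.1 (by omega))) ?_
    rintro υ ⟨h1, h2, h3⟩
    exact ⟨⟨h1, h3.trans hpot⟩, h2⟩
  · rintro τ ⟨hI', hpot⟩ hc
    simp only [eval_x, hI'.card, Finset.card_eq_zero] at hc
    have hpart := hI'.part
    rw [hc] at hpart
    refine ⟨hpart.isMECDecomposition, L, h, hL, hh', ?_, ?_⟩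
    · have hle : h * τ.ops ≤ potential L h idx σ := by
        refine le_trans ?_ hpot
        unfold potential
        omega
      unfold potential at hle
      rw [h3, h4, Finset.card_univ] at hle
      have h5 := ops_le_of_potential_le (by omega) hLpos hhpos hh (Finset.card_le_univ _) hops hle
      have h6 : 0 < Fintype.card V * h * L := by positivity
      change τ.ops + 1 ≤ _
      omega
    · change τ.vertRegs + τ.edgeRegs ≤ _
      have := hI'.env.vertRegs
      have := hI'.env.edgeRegs
      omega

/-! ### Real estimates -/

theorem half_le_log {n : ℕ} (hn : 1 < n) : 1 / 2 ≤ Real.log n :=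
  (by linarith [Real.log_two_gt_d9] : (1 : ℝ) / 2 ≤ Real.log 2).trans
    (Real.log_le_log (by norm_num) (by exact_mod_cast hn))

/-- Logarithms give L log 2 ≤ log 2 + log n ≤ 2 log n, and log 2 ≥ 1/2. -/
theorem natCast_le_log_of_two_pow_le {n L : ℕ} (hn : 1 < n) (h : 2 ^ L ≤ 2 * n) :
    (L : ℝ) ≤ 4 * Real.log n := by
  have h1 : (2 : ℝ) ^ L ≤ 2 * n := by exact_mod_cast h
  have hn' : (2 : ℝ) ≤ n := by exact_mod_cast hn
  have h2 := Real.log_le_log (by positivity) h1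
  rw [Real.log_pow, Real.log_mul (by norm_num) (by positivity)] at h2
  have h3 := Real.log_le_log (by norm_num) hn'
  have h4 : 1 / 2 ≤ Real.log 2 := by linarith [Real.log_two_gt_d9]
  nlinarith [Nat.cast_nonneg (α := ℝ) L]

theorem natCast_le_sqrt_of_mul_self_le {n h : ℕ} (hh : h * h ≤ 4 * n) :
    (h : ℝ) ≤ 2 * Real.sqrt n := by
  have h1 : (h : ℝ) * h ≤ 4 * n := by exact_mod_cast hh
  refine abs_le_of_sq_le_sq' ?_ (by positivity) |>.2
  rw [mul_pow, Real.sq_sqrt (by positivity)]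
  linarith

theorem mul_sqrt_eq_rpow {y : ℝ} (hy : 0 < y) : y * Real.sqrt y = y ^ (3 / 2 : ℝ) := by
  rw [Real.sqrt_eq_rpow, ← Real.rpow_one_add' hy.le (by norm_num)]
  norm_num

/-- The program that computes the MEC decomposition; it ignores its parameter. -/
def mecProgram : Program := ⟨mecDecomposition, []⟩

/-- The constants are 672 = 84 · 2 · 4, from h ≤ 2√n and L ≤ 4 log n, and 28 = 24 + 4, from 12 ≤ 24
log n. -/
theorem mecProgram_computesMECs [Nonempty V] (P : MDP V) (k : ℕ) {T S : ℝ}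
    (hT : 672 * ((Fintype.card V : ℝ) ^ (3 / 2 : ℝ) * Real.log (Fintype.card V)) ≤ T)
    (hS : 28 * Real.log (Fintype.card V) ≤ S) : mecProgram.ComputesMECs P k T S := by
  intro choice hch
  obtain ⟨τ, hτ, hout, L, h, hL, hh, hops, hspace⟩ := mecDecomposition_spec hch P k
  have hn := P.one_lt_card
  have h1 := natCast_le_log_of_two_pow_le hn hL
  have h2 := natCast_le_sqrt_of_mul_self_le hh
  have h3 := half_le_log hn
  refine ⟨τ, hτ, hout, le_trans ?_ hT, le_trans ?_ hS⟩
  · have hops' : (τ.ops : ℝ) ≤ 84 * (Fintype.card V * h * L) := by exact_mod_cast hops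
    refine hops'.trans ?_
    rw [← mul_sqrt_eq_rpow (by positivity)]
    calc (84 : ℝ) * (Fintype.card V * h * L)
        ≤ 84 * (Fintype.card V * (2 * Real.sqrt (Fintype.card V)) *
            (4 * Real.log (Fintype.card V))) := by gcongr
      _ = _ := by ring
  · have hspace' : (τ.space : ℝ) ≤ 12 + L := by exact_mod_cast hspace
    linarith

theorem mecProgram_computesMECs_of_le_half [Nonempty V] (P : MDP V) (k : ℕ) {ε : ℝ} (hε : 0 < ε)
    (hε' : ε ≤ 1 / 2) : mecProgram.ComputesMECs P k
      (672 * ((Fintype.card V : ℝ) ^ (2 - ε) * Real.log (Fintype.card V)))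
      (672 * ((Fintype.card V : ℝ) ^ ε * Real.log (Fintype.card V))) := by
  have hn : (1 : ℝ) ≤ Fintype.card V := by exact_mod_cast P.one_lt_card.le
  have hlog := half_le_log P.one_lt_card
  refine mecProgram_computesMECs P k ?_ ?_
  · gcongr
    linarith
  · have h1 : 1 ≤ (Fintype.card V : ℝ) ^ ε := Real.one_le_rpow hn hε.le
    nlinarith

end Symbolic

theorem mainTheorem1 :
    (∃ prog : Symbolic.Program, ∀ ε : ℝ, 0 < ε → ε ≤ 1 / 2 → ∃ C : ℝ,
      ∀ (V : Type*) [Fintype V] [DecidableEq V] [Nonempty V] (P : MDP V),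
        prog.ComputesMECs P ⌈(Fintype.card V : ℝ) ^ ε⌉₊
          (C * ((Fintype.card V : ℝ) ^ (2 - ε) * Real.log (Fintype.card V)))
          (C * ((Fintype.card V : ℝ) ^ ε * Real.log (Fintype.card V)))) ∧
    (∀ ε : ℚ, 0 < ε → ε ≤ 1 / 2 → ∃ prog : Symbolic.Program, ∃ C : ℝ,
      ∀ (V : Type*) [Fintype V] [DecidableEq V] [Nonempty V] (P : MDP V),
        prog.ComputesMECs P 0
          (C * ((Fintype.card V : ℝ) ^ (2 - (ε : ℝ)) * Real.log (Fintype.card V)))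
          (C * ((Fintype.card V : ℝ) ^ (ε : ℝ) * Real.log (Fintype.card V)))) ∧
    (∃ prog : Symbolic.Program, ∃ C : ℝ,
      ∀ (V : Type*) [Fintype V] [DecidableEq V] [Nonempty V] (P : MDP V),
        prog.ComputesMECs P 0
          (C * ((Fintype.card V : ℝ) ^ (3 / 2 : ℝ) * Real.log (Fintype.card V)))
          (C * (Real.sqrt (Fintype.card V) * Real.log (Fintype.card V)))) := by
  refine ⟨⟨Symbolic.mecProgram, fun ε hε hε' => ⟨672, fun V _ _ _ P =>
    Symbolic.mecProgram_computesMECs_of_le_half P _ hε hε'⟩⟩, fun ε hε hε' =>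
    ⟨Symbolic.mecProgram, 672, fun V _ _ _ P => Symbolic.mecProgram_computesMECs_of_le_half P 0
      (by exact_mod_cast hε) (by rw [← Rat.cast_le (K := ℝ)] at hε'; simpa using hε')⟩,
    Symbolic.mecProgram, 672, fun V _ _ _ P => ?_⟩
  -- The square-root bounds are the case ε = 1/2.
  have h := Symbolic.mecProgram_computesMECs_of_le_half P 0 (ε := 1 / 2) (by norm_num) le_rfl
  rw [Real.sqrt_eq_rpow, show (3 / 2 : ℝ) = 2 - 1 / 2 by norm_num]
  exact h
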